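/- **Conventions.** Let $R$ be a commutative noetherian local ring with maximal ideal $\mathfrak m$. An $R$-complex $X$ is a chain complex of $R$-modules indexed homologically by $\mathbb Z$. Put $\inf X=\inf\{i\mid H_i(X)\neq 0\}$ and $\operatorname{Supp}X=\bigcup_i\operatorname{Supp}H_i(X)$. The complex $X$ is homologically finite if $\coprod_i H_i(X)$ is a finitely generated $R$-module. Its Krull dimension (over $R$, and likewise over any commutative noetherian ring) is $$\dim_R X=\sup\{\dim (R/\mathfrak p)-\inf X_{\mathfrak p}\mid \mathfrak p\in\operatorname{Supp}X\}.$$ A prime $\mathfrak p\in\operatorname{Supp}X$ is an anchor prime for $X$ if $\dim_{R_{\mathfrak p}}X_{\mathfrak p}=-\inf X_{\mathfrak p}$. Let $K^R(\mathbf x)$ denote the Koszul complex on a finite sequence $\mathbf x=x_1,\dots,x_d\in\mathfrak m$, and let $X$ be homologically finite. * $\mathbf x$ is a *Christensen system of parameters* for $X$ if $\mathfrak m$ is an anchor prime for $K^R(\mathbf x)\otimes^{\mathbf L}_RX$ and $d=\dim_RX+\inf X$. * $\mathbf x$ is a *length sequence* for $X$ if each $H_i(K^R(\mathbf x)\otimes^{\mathbf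 L}_RX)$ has finite length. The *length dimension* of $X$ is $\operatorname{ldim}_RX=m-\inf X$, where $m$ is the length of a shortest length sequence for $X$. A *length system of parameters* for $X$ is a length sequence of length $\operatorname{ldim}_RX+\inf X$. * $\mathbf x$ is a *system of parameters* for a nonzero finitely generated $R$-module $M$ if $M/\mathbf xM$ has finite length and $d=\dim M$. Let $(A_0,\mathfrak m_0)$ be a commutative noetherian local ring, and let $A$ be a positively graded commutative DG $A_0$-algebra with degree-$0$ component $A_0$. That is, $A$ is an associative unital graded algebra $\bigoplus_{i\ge 0}A_i$ with $ba=(-1)^{|a||b|}ab$ for all homogeneous $a,b$, with $a^2=0$ for $a$ homogeneous of odd degree, and with a differential $\partial$ of degree $-1$ that satisfies the Leibniz rule $\partial(ab)=\partial(a)b+(-1)^{|a|}a\,\partial(b)$. Then $H_0(A)=A_0/\partial(A_1)$ is a ring. The DG algebra $A$ is *noetherian* if $H_0(A)$ is a noetherian ring and each $H_i(A)$ is a finitely generated $H_0(A)$-module. It is *local* if it is noetherian and $H_0(A)$ is a local ring whose maximal ideal contains $\mathfrak m_0H_0(A)$. A *DG prime ideal* of $A$ is a homogeneous ideal that is closed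 under $\partial$ and is prime as an ideal of the underlying algebra $\bigoplus_iA_i$. The *DG Krull dimension* $\operatorname{DGdim}A$ is the supremum of the lengths of chains of DG prime ideals of $A$. **Theorem.** Assume that $A$ is homologically finite (as an $A_0$-complex), noetherian and local. (a) For every finite sequence $\mathbf x\in\mathfrak m_0$, the following conditions are equivalent: (i) $\mathbf x$ is a Christensen system of parameters for $A$; (ii) $\mathbf x$ is a system of parameters for $H_0(A)$; (iii) $\mathbf x$ is a length system of parameters for $A$. (b) One has $\operatorname{ldim}_{A_0}A=\dim_{A_0}A=\dim H_0(A)$. (c) If $A$ is generated as an $A_0$-algebra by homogeneous elements of odd degree, or if $A$ is bounded (that is, $A_i=0$ for $i\gg 0$), then $\operatorname{DGdim}A=\operatorname{ldim}_{A_0}A=\dim_{A_0}A=\dim H_0(A)$. -/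

import Mathlib

open CategoryTheory MonoidalCategory

universe u

/-- Total degree and the usual Koszul sign `(-1)^p` for tensor products of homologically indexed
`ℤ`-complexes: `∂(x ⊗ y) = ∂x ⊗ y + (-1)^p x ⊗ ∂y` for `x` of degree `p`. With this instance,
Mathlib's monoidal structure applies to `ChainComplex (ModuleCat R) ℤ`. -/
instance tensorSignsDownInt : ComplexShape.TensorSigns (ComplexShape.down ℤ) where
  ε' := MonoidHom.mk' Int.negOnePow Int.negOnePow_add
  rel_add p q r (hpq : q + 1 = p) := by change q + r + 1 = p + r; lia
  add_rel p q r (hpq : q + 1 = p) := by change r + q + 1 = r + p; lia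
  ε'_succ p q (h : q + 1 = p) := by
    subst h
    change q.negOnePow = - (q + 1).negOnePow
    simp [Int.negOnePow_succ]

/-- `R`-complexes: chain complexes of `R`-modules, indexed homologically by `ℤ`. -/
abbrev RComplex (R : Type u) [CommRing R] := ChainComplex (ModuleCat.{u} R) ℤ

/-- The inclusion of `{-∞} ∪ ℕ ∪ {∞}`, where Krull dimensions live, in the extended reals. -/
noncomputable def dimToEReal : WithBot ℕ∞ → EReal :=
  WithBot.recBotCoe ⊥ fun n : ℕ∞ => (((n : ENNReal)) : EReal)

namespace RComplex

section Basic

variable {R : Type u} [CommRing R]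

/-- `inf X = inf {i | H_i(X) ≠ 0}`, with `inf ∅ = ∞`. -/
noncomputable def inf (X : RComplex R) : EReal :=
  ⨅ (i : ℤ) (_ : Nontrivial (X.homology i)), ((i : ℝ) : EReal)

/-- `X` is homologically finite: the total homology `∐ H_i(X)` is a finitely generated module. -/
def HomologicallyFinite (X : RComplex R) : Prop :=
  Module.Finite R (DirectSum ℤ fun i => X.homology i)

/-- `Supp X = ⋃ Supp H_i(X)`. -/
def supp (X : RComplex R) : Set (PrimeSpectrum R) :=
  ⋃ i : ℤ, Module.support R (X.homology i)

/-- The localized complex `X_𝔭` over `R_𝔭`. -/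
noncomputable def localizedAt (X : RComplex R) (p : PrimeSpectrum R) :
    RComplex (Localization p.asIdeal.primeCompl) :=
  ((ModuleCat.localizedModuleFunctor.{u} p.asIdeal.primeCompl).mapHomologicalComplex _).obj X

/-- The Krull dimension of a complex: `sup {dim R/𝔭 - inf X_𝔭 | 𝔭 ∈ Supp X}`. -/
noncomputable def dim (X : RComplex R) : EReal :=
  ⨆ p ∈ X.supp, dimToEReal (ringKrullDim (R ⧸ p.asIdeal)) - (X.localizedAt p).inf

/-- `𝔭` is an anchor prime for `X`: `𝔭 ∈ Supp X` and `dim X_𝔭 = - inf X_𝔭`, where `dim X_𝔭` is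
taken over `R_𝔭`. -/
def IsAnchor (X : RComplex R) (p : PrimeSpectrum R) : Prop :=
  p ∈ X.supp ∧ (X.localizedAt p).dim = - (X.localizedAt p).inf

/-- The Koszul complex `0 → R --x--> R → 0` on one element, in degrees `1` and `0`. -/
noncomputable def koszulOne (x : R) : RComplex R :=
  HomologicalComplex.double (c := ComplexShape.down ℤ) (i₀ := 1) (i₁ := 0)
    (ModuleCat.ofHom (LinearMap.lsmul R R x) : ModuleCat.of R R ⟶ ModuleCat.of R R)
    (by simp)

/-- The Koszul complex `K(x₁, …, xₙ) = K(x₁) ⊗ ⋯ ⊗ K(xₙ)`; the empty one is `R` in degree `0`. -/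
noncomputable def koszul : List R → RComplex R
  | [] => 𝟙_ (RComplex R)
  | x :: xs => koszulOne x ⊗ koszul xs

/-- `K(x₁, …, xₙ) ⊗ X`. As the Koszul complex is a bounded complex of finitely generated free
modules, this also is the derived tensor product. -/
noncomputable def koszulTensor (xs : List R) (X : RComplex R) : RComplex R :=
  koszul xs ⊗ X

end Basic

section Local

variable {R : Type u} [CommRing R] [IsLocalRing R]

/-- Christensen's systems of parameters for a complex `X`: sequences `x₁, …, x_d ∈ 𝔪` such that
`𝔪` is an anchor prime for `K(x₁, …, x_d) ⊗ X`, and `d = dim X + inf X`. -/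
def IsChristensenSOP (xs : List R) (X : RComplex R) : Prop :=
  (∀ x ∈ xs, x ∈ IsLocalRing.maximalIdeal R) ∧
    (koszulTensor xs X).IsAnchor (IsLocalRing.closedPoint R) ∧
    (xs.length : EReal) = X.dim + X.inf

/-- Length sequences for `X`: sequences `x₁, …, x_d ∈ 𝔪` such that each homology module of
`K(x₁, …, x_d) ⊗ X` has finite length. -/
def IsLengthSequence (xs : List R) (X : RComplex R) : Prop :=
  (∀ x ∈ xs, x ∈ IsLocalRing.maximalIdeal R) ∧
    ∀ i : ℤ, IsFiniteLength R ((koszulTensor xs X).homology i)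

/-- The length dimension of `X`: `m - inf X`, where `m` is the length of a shortest length
sequence for `X`. -/
noncomputable def ldim (X : RComplex R) : EReal :=
  (⨅ (xs : List R) (_ : IsLengthSequence xs X), (xs.length : EReal)) - X.inf

/-- Length systems of parameters for `X`: length sequences `x₁, …, x_m` with
`m = ldim X + inf X`. -/
def IsLengthSOP (xs : List R) (X : RComplex R) : Prop :=
  IsLengthSequence xs X ∧ (xs.length : EReal) = X.ldim + X.inf

end Local

end RComplex

/-- Systems of parameters `x₁, …, x_d ∈ 𝔪` for a (finitely generated, nonzero) module `M` over a
local ring `(R, 𝔪)`: `M/(x₁, …, x_d)M` has finite length, and `d = dim M`. -/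
def IsModuleSOP {R : Type u} [CommRing R] [IsLocalRing R] (xs : List R)
    (M : Type u) [AddCommGroup M] [Module R M] : Prop :=
  (∀ x ∈ xs, x ∈ IsLocalRing.maximalIdeal R) ∧
    IsFiniteLength R (M ⧸ (Ideal.ofList xs • (⊤ : Submodule R M))) ∧
    (xs.length : WithBot ℕ∞) = Module.supportDim R M

section DGAlgebra

variable {A₀ : Type u} [CommRing A₀] {A : Type u} [Ring A] [Algebra A₀ A]

/-- A positively graded commutative DG `A₀`-algebra whose degree `0` part is `A₀`. Here `A` is the
underlying algebra, `𝒜 i` is its component of degree `i`, and `d` is the differential. -/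
structure IsDGAlgebra (𝒜 : ℤ → Submodule A₀ A) [GradedAlgebra 𝒜] (d : A →ₗ[A₀] A) : Prop where
  /-- `A` is positively graded. -/
  eq_bot_of_neg : ∀ i < 0, 𝒜 i = ⊥
  /-- The structure map identifies `A₀` with the component of degree `0`. -/
  algebraMap_injective : Function.Injective (algebraMap A₀ A)
  exists_algebraMap_eq : ∀ a ∈ 𝒜 0, ∃ r, algebraMap A₀ A r = a
  /-- Graded commutativity. -/
  mul_comm' : ∀ ⦃i j : ℤ⦄ ⦃a b : A⦄, a ∈ 𝒜 i → b ∈ 𝒜 j → b * a = (i * j).negOnePow • (a * b)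
  mul_self_of_odd : ∀ ⦃i : ℤ⦄ ⦃a : A⦄, Odd i → a ∈ 𝒜 i → a * a = 0
  /-- `d` is a differential of degree `-1`. -/
  d_mem : ∀ ⦃i : ℤ⦄ ⦃a : A⦄, a ∈ 𝒜 i → d a ∈ 𝒜 (i - 1)
  d_d : ∀ a, d (d a) = 0
  /-- The Leibniz rule. -/
  leibniz : ∀ ⦃i j : ℤ⦄ ⦃a b : A⦄, a ∈ 𝒜 i → b ∈ 𝒜 j →
    d (a * b) = d a * b + i.negOnePow • (a * d b)

namespace IsDGAlgebra

/-- The complex of `A₀`-modules `⋯ → 𝒜 2 → 𝒜 1 → 𝒜 0 → 0` underlying a DG algebra. -/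
noncomputable def toComplex {𝒜 : ℤ → Submodule A₀ A} [GradedAlgebra 𝒜] {d : A →ₗ[A₀] A}
    (h : IsDGAlgebra 𝒜 d) : RComplex A₀ where
  X i := ModuleCat.of A₀ (𝒜 i)
  d i j := if hij : j + 1 = i then
      ModuleCat.ofHom (d.restrict (p := 𝒜 i) (q := 𝒜 j) fun a ha => by
        have := h.d_mem ha
        rwa [← hij, add_sub_cancel_right] at this)
    else 0
  shape i j hij := dif_neg hij
  d_comp_d' i j k hij hjk := by
    change j + 1 = i at hij
    change k + 1 = j at hjk
    rw [dif_pos hij, dif_pos hjk]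
    exact ModuleCat.hom_ext (LinearMap.ext fun a => Subtype.ext (h.d_d a))

end IsDGAlgebra

/-- The ideal `im(∂₁)` of `A₀`. -/
def boundaryIdeal (𝒜 : ℤ → Submodule A₀ A) (d : A →ₗ[A₀] A) : Ideal A₀ :=
  ((𝒜 1).map d).comap (Algebra.linearMap A₀ A)

/-- The ring `H₀(A) = A₀ / im(∂₁)`. -/
abbrev HZero (𝒜 : ℤ → Submodule A₀ A) (d : A →ₗ[A₀] A) : Type u :=
  A₀ ⧸ boundaryIdeal 𝒜 d

/-- A DG algebra is noetherian if `H₀(A)` is a noetherian ring and every `H_i(A)` is a finitely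
generated `H₀(A)`-module. The latter is the same as being finitely generated over `A₀`, as `A₀`
acts on `H_i(A)` through its quotient `H₀(A)`. -/
structure IsDGAlgebra.IsNoetherian {𝒜 : ℤ → Submodule A₀ A} [GradedAlgebra 𝒜] {d : A →ₗ[A₀] A}
    (h : IsDGAlgebra 𝒜 d) : Prop where
  isNoetherianRing : IsNoetherianRing (HZero 𝒜 d)
  finite_homology : ∀ i : ℤ, Module.Finite A₀ (h.toComplex.homology i)

/-- A DG algebra over a local ring `A₀` is local if it is noetherian and `H₀(A)` is a local ring
whose maximal ideal contains the image of the maximal ideal of `A₀`. -/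
structure IsDGAlgebra.IsLocal [IsLocalRing A₀] {𝒜 : ℤ → Submodule A₀ A} [GradedAlgebra 𝒜]
    {d : A →ₗ[A₀] A} (h : IsDGAlgebra 𝒜 d) : Prop where
  isNoetherian : h.IsNoetherian
  isLocalRing : IsLocalRing (HZero 𝒜 d)
  map_maximalIdeal_le : (IsLocalRing.maximalIdeal A₀).map (Ideal.Quotient.mk (boundaryIdeal 𝒜 d)) ≤
    IsLocalRing.maximalIdeal (HZero 𝒜 d)

/-- DG prime ideals: homogeneous ideals of `A` that are closed under the differential and are prime
as ideals of the underlying algebra (proper, and `ab ∈ I` implies `a ∈ I` or `b ∈ I`). By graded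
commutativity, homogeneous left ideals are two-sided. -/
structure IsDGPrime (𝒜 : ℤ → Submodule A₀ A) [GradedAlgebra 𝒜] (d : A →ₗ[A₀] A)
    (I : Ideal A) : Prop where
  isHomogeneous : I.IsHomogeneous 𝒜
  d_mem : ∀ a ∈ I, d a ∈ I
  isPrime : I.IsPrime

/-- The DG Krull dimension: the supremum of the lengths of chains of DG prime ideals. -/
noncomputable def dgDim (𝒜 : ℤ → Submodule A₀ A) [GradedAlgebra 𝒜] (d : A →ₗ[A₀] A) :
    WithBot ℕ∞ :=
  Order.krullDim {I : Ideal A // IsDGPrime 𝒜 d I}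

/-- `A` is generated over `A₀` in odd degrees: homogeneous elements of odd degree generate `A` as
an `A₀`-algebra. -/
def GeneratedInOddDegrees (𝒜 : ℤ → Submodule A₀ A) : Prop :=
  Algebra.adjoin A₀ {a : A | ∃ i : ℤ, Odd i ∧ a ∈ 𝒜 i} = ⊤

/-- `A` (which is positively graded) is bounded: `A_i = 0` for all large `i`. -/
def IsBoundedDG (𝒜 : ℤ → Submodule A₀ A) : Prop :=
  ∃ N : ℤ, ∀ i > N, 𝒜 i = ⊥

end DGAlgebra

/-!
Let `J` be the ideal of boundaries in `A₀`, so that `H₀(A) = A₀/J`. If `r = ∂a` lies in `J` and `z`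
is a cycle, then `r z = ∂(a z)`; hence `J` kills the homology of `A`, and the support of `A` is the
support `V(J)` of `H₀(A)`. As `A` lives in nonnegative degrees, every localization of `A` at a prime
in `V(J)` has infimum `0`, and `dim A` is just the supremum of the `dim A₀/p` for `p ∈ V(J)`, which
is `dim H₀(A)`.

These features are collected in `RComplex.HasCyclicBottom Y J`: the homology of `Y` is finitely
generated in each degree, vanishes in negative degrees, is `R/J` in degree `0`, and `J` acts
nilpotently on it. They are inherited by localizations (`HasCyclicBottom.localizedAt`), and by
Koszul complexes (`HasCyclicBottom.koszulTensor`): if `Y` has them for `J`, then `K(xs) ⊗ Y` has them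
for `J + (xs)`. The case of one element `x` rests on the exact sequence
`H_j(Y) → H_j(K(x) ⊗ Y) → H_{j-1}(Y)`, in which the kernel of the first map is `x H_j(Y)`, and on
the fact that `x` kills `H_j(K(x) ⊗ Y)`; both are read off the decomposition
`(K(x) ⊗ Y)_n = Y_n ⊕ Y_{n-1}`.

So for a sequence `xs` in the maximal ideal, the maximal ideal is an anchor prime for `K(xs) ⊗ A` if
and only if `A₀/(J + (xs))` has dimension `0`, and the same condition says that all homology of
`K(xs) ⊗ A` has finite length, and that `H₀(A)/(xs)H₀(A)` has. By Krull's theorems the shortest such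
sequences have length `dim A₀/J`. This gives the equivalence of the three kinds of systems of
parameters (`HasCyclicBottom.tfae_systemOfParameters`) and the formulas for the two dimensions
(`HasCyclicBottom.dim_eq`, `HasCyclicBottom.ldim_eq`).

If `A` is bounded or generated in odd degrees, then each DG prime contains all elements of positive
degree, since enough of them are nilpotent. A DG prime is then determined by its part of degree `0`,
which is a prime of `A₀` containing `∂(A₁)`, and all primes containing `J` arise. This is
`IsDGAlgebra.dgPrimeOrderIso`.
-/

/-! ### Homology classes in complexes of modules -/

namespace CategoryTheory.ShortComplex

variable {R : Type u} [CommRing R]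

/-- The class in `S.homology` of a cycle. -/
noncomputable def homologyClass (S : ShortComplex (ModuleCat.{u} R)) :
    LinearMap.ker S.g.hom →ₗ[R] S.homology :=
  S.moduleCatHomologyIso.inv.hom ∘ₗ (LinearMap.range S.moduleCatToCycles).mkQ

variable (S : ShortComplex (ModuleCat.{u} R))

lemma homologyClass_surjective : Function.Surjective S.homologyClass :=
  ((ConcreteCategory.bijective_of_isIso S.moduleCatHomologyIso.inv).2).comp
    (Submodule.mkQ_surjective _)

lemma homologyClass_eq_zero_iff (z : LinearMap.ker S.g.hom) :
    S.homologyClass z = 0 ↔ ∃ y, S.f.hom y = z.1 := by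
  have hinj := (ConcreteCategory.bijective_of_isIso S.moduleCatHomologyIso.inv).1
  have : S.homologyClass z = 0 ↔ (LinearMap.range S.moduleCatToCycles).mkQ z = 0 :=
    map_eq_zero_iff S.moduleCatHomologyIso.inv.hom hinj
  rw [this, Submodule.mkQ_apply, Submodule.Quotient.mk_eq_zero, LinearMap.mem_range]
  exact exists_congr fun y => by rw [Subtype.ext_iff]; rfl

lemma homologyMap_homologyClass {S T : ShortComplex (ModuleCat.{u} R)} (φ : S ⟶ T)
    (z : LinearMap.ker S.g.hom) (w : LinearMap.ker T.g.hom) (h : φ.τ₂.hom z.1 = w.1) :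
    (homologyMap φ).hom (S.homologyClass z) = T.homologyClass w := by
  have key (S : ShortComplex (ModuleCat.{u} R)) (z : LinearMap.ker S.g.hom) :
      S.homologyClass z = S.homologyπ.hom (S.moduleCatCyclesIso.inv.hom z) := by
    have := S.moduleCatCyclesIso_inv_π
    have := congr($(this).hom z)
    exact this.symm
  have hc : (cyclesMap φ).hom (S.moduleCatCyclesIso.inv.hom z) =
      T.moduleCatCyclesIso.inv.hom w := by
    apply (ModuleCat.mono_iff_injective T.iCycles).1 inferInstance
    have h1 := congr($(cyclesMap_i φ).hom (S.moduleCatCyclesIso.inv.hom z))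
    have h2 := congr($(S.moduleCatCyclesIso_inv_iCycles).hom z)
    have h3 := congr($(T.moduleCatCyclesIso_inv_iCycles).hom w)
    exact h1.trans ((congrArg φ.τ₂.hom h2).trans (h.trans h3.symm))
  rw [key, key, ← hc]
  exact congr($(homologyπ_naturality φ).hom (S.moduleCatCyclesIso.inv.hom z))

end CategoryTheory.ShortComplex
/-! ### The decomposition of `K(x) ⊗ Y` -/

namespace RComplex
variable {R : Type u} [CommRing R]
section
variable (x : R)

/-- The identification of the degree `0` part of `koszulOne x` with `R`. -/
noncomputable def koszulOneXZero : (koszulOne x).X 0 ≅ 𝟙_ (ModuleCat.{u} R) :=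
  HomologicalComplex.doubleXIso₁ _ _ (by decide)

/-- The identification of the degree `1` part of `koszulOne x` with `R`. -/
noncomputable def koszulOneXOne : (koszulOne x).X 1 ≅ 𝟙_ (ModuleCat.{u} R) :=
  HomologicalComplex.doubleXIso₀ _ _

lemma koszulOne_d : (koszulOne x).d 1 0 =
    (koszulOneXOne x).hom ≫ (x • 𝟙 (𝟙_ (ModuleCat.{u} R))) ≫ (koszulOneXZero x).inv := by
  refine (HomologicalComplex.double_d _ _ (by decide)).trans ?_
  congr 2

variable (Y : RComplex R)

/-- The inclusion of `Y_n` in `(K(x) ⊗ Y)_n = Y_n ⊕ Y_{n-1}`. -/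
noncomputable def toTensor (n : ℤ) : Y.X n ⟶ (koszulOne x ⊗ Y).X n :=
  (λ_ _).inv ≫ (koszulOneXZero x).inv ▷ _ ≫
    HomologicalComplex.ιTensorObj (koszulOne x) Y 0 n n (zero_add n)

/-- The inclusion of `Y_{n-1}` in `(K(x) ⊗ Y)_n = Y_n ⊕ Y_{n-1}`; here `m` stands for `n - 1`. -/
noncomputable def shiftToTensor (m n : ℤ) (h : 1 + m = n) : Y.X m ⟶ (koszulOne x ⊗ Y).X n :=
  (λ_ _).inv ≫ (koszulOneXOne x).inv ▷ _ ≫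
    HomologicalComplex.ιTensorObj (koszulOne x) Y 1 m n h

/-- The projection of `(K(x) ⊗ Y)_n = Y_n ⊕ Y_{n-1}` to `Y_n`. -/
noncomputable def ofTensor (n : ℤ) : (koszulOne x ⊗ Y).X n ⟶ Y.X n :=
  HomologicalComplex.mapBifunctorDesc (K₁ := koszulOne x) (K₂ := Y)
    (F := curriedTensor (ModuleCat.{u} R)) (c := ComplexShape.down ℤ) fun i₁ i₂ h =>
    if h₁ : i₁ = 0 then
      (eqToHom (by rw [h₁]) ≫ (koszulOneXZero x).hom) ▷ _ ≫ (λ_ _).hom ≫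
        eqToHom (by rw [show i₂ = n by rw [← h, h₁]; exact (zero_add i₂).symm])
    else 0

/-- The projection of `(K(x) ⊗ Y)_n = Y_n ⊕ Y_{n-1}` to `Y_{n-1}`; here `m` stands for `n - 1`. -/
noncomputable def ofTensorShift (m n : ℤ) (hm : 1 + m = n) : (koszulOne x ⊗ Y).X n ⟶ Y.X m :=
  HomologicalComplex.mapBifunctorDesc (K₁ := koszulOne x) (K₂ := Y)
    (F := curriedTensor (ModuleCat.{u} R)) (c := ComplexShape.down ℤ) fun i₁ i₂ h =>
    if h₁ : i₁ = 1 then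
      (eqToHom (by rw [h₁]) ≫ (koszulOneXOne x).hom) ▷ _ ≫ (λ_ _).hom ≫
        eqToHom (by
          have : 1 + i₂ = n := by rw [← h, h₁]; rfl
          rw [show i₂ = m by lia])
    else 0

lemma toTensor_ofTensor (n : ℤ) : toTensor x Y n ≫ ofTensor x Y n = 𝟙 _ := by
  simp only [toTensor, ofTensor, Category.assoc]
  erw [HomologicalComplex.ι_mapBifunctorDesc]
  simp

lemma shiftToTensor_ofTensorShift (m n : ℤ) (h : 1 + m = n) :
    shiftToTensor x Y m n h ≫ ofTensorShift x Y m n h = 𝟙 _ := by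
  simp only [shiftToTensor, ofTensorShift, Category.assoc]
  erw [HomologicalComplex.ι_mapBifunctorDesc]
  simp

lemma toTensor_ofTensorShift (m n : ℤ) (h : 1 + m = n) :
    toTensor x Y n ≫ ofTensorShift x Y m n h = 0 := by
  simp only [toTensor, ofTensorShift, Category.assoc]
  erw [HomologicalComplex.ι_mapBifunctorDesc]
  simp

lemma shiftToTensor_ofTensor (m n : ℤ) (h : 1 + m = n) :
    shiftToTensor x Y m n h ≫ ofTensor x Y n = 0 := by
  simp only [shiftToTensor, ofTensor, Category.assoc]
  erw [HomologicalComplex.ι_mapBifunctorDesc]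
  simp

lemma tensor_decomposition (m n : ℤ) (h : 1 + m = n) :
    ofTensor x Y n ≫ toTensor x Y n + ofTensorShift x Y m n h ≫ shiftToTensor x Y m n h = 𝟙 _ := by
  refine HomologicalComplex.mapBifunctor.hom_ext fun i₁ i₂ hi => ?_
  rw [Preadditive.comp_add]
  simp only [ofTensor, ofTensorShift]
  erw [HomologicalComplex.ι_mapBifunctorDesc_assoc, HomologicalComplex.ι_mapBifunctorDesc_assoc]
  by_cases h0 : i₁ = 0
  · subst h0
    obtain rfl : i₂ = n := by rw [← hi]; exact (zero_add i₂).symm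
    simp [toTensor, ← comp_whiskerRight_assoc]
    rfl
  by_cases h1 : i₁ = 1
  · subst h1
    obtain rfl : i₂ = m := by
      have : 1 + i₂ = n := hi
      lia
    simp [shiftToTensor, ← comp_whiskerRight_assoc]
    rfl
  · have hz : Limits.IsZero ((koszulOne x).X i₁) :=
      HomologicalComplex.isZero_double_X _ _ _ h1 h0
    have : Limits.IsZero ((koszulOne x).X i₁ ⊗ Y.X i₂) := by
      rw [Limits.IsZero.iff_id_eq_zero, ← id_whiskerRight, hz.eq_of_src (𝟙 _) 0]
      simp
    exact this.eq_of_src _ _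

lemma toTensor_d (n n' : ℤ) (h : n' + 1 = n) :
    toTensor x Y n ≫ (koszulOne x ⊗ Y).d n n' = Y.d n n' ≫ toTensor x Y n' := by
  simp only [toTensor, Category.assoc]
  have h1 : HomologicalComplex.mapBifunctor.d₁ (koszulOne x) Y (curriedTensor _)
      (ComplexShape.down ℤ) 0 n n' = 0 := by
    rw [HomologicalComplex.mapBifunctor.d₁_eq' _ _ _ _ (show (ComplexShape.down ℤ).Rel 0 (-1) by simp),
      show (koszulOne x).d 0 (-1) = 0 from HomologicalComplex.double_d_eq_zero₀ _ _ _ _ (by decide)]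
    simp
  have h2 := HomologicalComplex.mapBifunctor.d₂_eq (koszulOne x) Y (curriedTensor _)
      (ComplexShape.down ℤ) 0 (show (ComplexShape.down ℤ).Rel n n' from h) n' (zero_add n')
  have h3 : HomologicalComplex.ιTensorObj (koszulOne x) Y 0 n n (zero_add n) ≫
      (koszulOne x ⊗ Y).d n n' = (koszulOne x).X 0 ◁ Y.d n n' ≫
        HomologicalComplex.ιTensorObj (koszulOne x) Y 0 n' n' (zero_add n') := by
    erw [HomologicalComplex.mapBifunctor.d_eq]
    rw [Preadditive.comp_add, HomologicalComplex.mapBifunctor.ι_D₁,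
      HomologicalComplex.mapBifunctor.ι_D₂, h1, h2, zero_add]
    erw [show ComplexShape.ε₂ (ComplexShape.down ℤ) (ComplexShape.down ℤ)
        (ComplexShape.down ℤ) ((0 : ℤ), n) = 1 from Int.negOnePow_zero, one_smul]
    rfl
  rw [h3]
  simp [← whisker_exchange_assoc]

/-- On the shifted copy of `Y`, the differential of `K(x) ⊗ Y` is that of `Y` up to sign, plus
multiplication by `x` into the unshifted copy. -/
lemma shiftToTensor_d (k m n : ℤ) (hk : 1 + k = m) (hm : 1 + m = n) :
    shiftToTensor x Y m n hm ≫ (koszulOne x ⊗ Y).d n m = x • toTensor x Y m -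
      Y.d m k ≫ shiftToTensor x Y k m hk := by
  simp only [shiftToTensor, toTensor, Category.assoc]
  have h1 := HomologicalComplex.mapBifunctor.d₁_eq (koszulOne x) Y (curriedTensor _)
      (ComplexShape.down ℤ) (show (ComplexShape.down ℤ).Rel 1 0 by simp) m m (zero_add m)
  have h2 := HomologicalComplex.mapBifunctor.d₂_eq (koszulOne x) Y (curriedTensor _)
      (ComplexShape.down ℤ) 1 (show (ComplexShape.down ℤ).Rel m k by rw [ComplexShape.down_Rel]; lia) m
      hk
  have h3 : HomologicalComplex.ιTensorObj (koszulOne x) Y 1 m n hm ≫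
      (koszulOne x ⊗ Y).d n m = (koszulOne x).d 1 0 ▷ _ ≫
        HomologicalComplex.ιTensorObj (koszulOne x) Y 0 m m (zero_add m) -
        (koszulOne x).X 1 ◁ Y.d m k ≫
        HomologicalComplex.ιTensorObj (koszulOne x) Y 1 k m hk := by
    erw [HomologicalComplex.mapBifunctor.d_eq]
    rw [Preadditive.comp_add, HomologicalComplex.mapBifunctor.ι_D₁,
      HomologicalComplex.mapBifunctor.ι_D₂, h1, h2]
    erw [show ComplexShape.ε₁ (ComplexShape.down ℤ) (ComplexShape.down ℤ) (ComplexShape.down ℤ)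
      ((1 : ℤ), m) = 1 from rfl, show ComplexShape.ε₂ (ComplexShape.down ℤ) (ComplexShape.down ℤ)
        (ComplexShape.down ℤ) ((1 : ℤ), m) = -1 from Int.negOnePow_one, one_smul]
    rw [Units.neg_smul, one_smul, ← sub_eq_add_neg]
    rfl
  rw [h3, koszulOne_d]
  simp [← whisker_exchange_assoc, Preadditive.comp_sub]

end

end RComplex

namespace RComplex
variable {R : Type u} [CommRing R]

section KoszulElements

variable (x : R) (Y : RComplex R)

lemma eq_toTensor_add_shiftToTensor {m n : ℤ} (h : 1 + m = n) (t : (koszulOne x ⊗ Y).X n) :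
    t = (toTensor x Y n).hom ((ofTensor x Y n).hom t) +
      (shiftToTensor x Y m n h).hom ((ofTensorShift x Y m n h).hom t) :=
  congr($(tensor_decomposition x Y m n h).hom t).symm

lemma d_toTensor {m n : ℤ} (h : 1 + m = n) (y : Y.X n) :
    ((koszulOne x ⊗ Y).d n m).hom ((toTensor x Y n).hom y) =
      (toTensor x Y m).hom ((Y.d n m).hom y) :=
  congr($(toTensor_d x Y n m (by lia)).hom y)

lemma d_shiftToTensor {k m n : ℤ} (hk : 1 + k = m) (h : 1 + m = n) (y : Y.X m) :
    ((koszulOne x ⊗ Y).d n m).hom ((shiftToTensor x Y m n h).hom y) =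
      x • (toTensor x Y m).hom y - (shiftToTensor x Y k m hk).hom ((Y.d m k).hom y) :=
  congr($(shiftToTensor_d x Y k m n hk h).hom y)

lemma ofTensor_toTensor_apply {n : ℤ} (y : Y.X n) :
    (ofTensor x Y n).hom ((toTensor x Y n).hom y) = y :=
  congr($(toTensor_ofTensor x Y n).hom y)

lemma ofTensorShift_shiftToTensor_apply {m n : ℤ} (h : 1 + m = n) (y : Y.X m) :
    (ofTensorShift x Y m n h).hom ((shiftToTensor x Y m n h).hom y) = y :=
  congr($(shiftToTensor_ofTensorShift x Y m n h).hom y)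

lemma ofTensorShift_toTensor_apply {m n : ℤ} (h : 1 + m = n) (y : Y.X n) :
    (ofTensorShift x Y m n h).hom ((toTensor x Y n).hom y) = 0 :=
  congr($(toTensor_ofTensorShift x Y m n h).hom y)

lemma ofTensor_shiftToTensor_apply {m n : ℤ} (h : 1 + m = n) (y : Y.X m) :
    (ofTensor x Y n).hom ((shiftToTensor x Y m n h).hom y) = 0 :=
  congr($(shiftToTensor_ofTensor x Y m n h).hom y)

lemma ofTensor_d {m n : ℤ} (h : 1 + m = n) (t : (koszulOne x ⊗ Y).X n) :
    (ofTensor x Y m).hom (((koszulOne x ⊗ Y).d n m).hom t) =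
      (Y.d n m).hom ((ofTensor x Y n).hom t) + x • (ofTensorShift x Y m n h).hom t := by
  have hk : 1 + (m - 1) = m := by lia
  conv_lhs => rw [eq_toTensor_add_shiftToTensor x Y h t]
  rw [map_add, map_add, d_toTensor x Y h, d_shiftToTensor x Y hk h, ofTensor_toTensor_apply,
    map_sub, map_smul, ofTensor_toTensor_apply, ofTensor_shiftToTensor_apply, sub_zero]

lemma ofTensorShift_d {k m n : ℤ} (hk : 1 + k = m) (h : 1 + m = n) (t : (koszulOne x ⊗ Y).X n) :
    (ofTensorShift x Y k m hk).hom (((koszulOne x ⊗ Y).d n m).hom t) =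
      - (Y.d m k).hom ((ofTensorShift x Y m n h).hom t) := by
  conv_lhs => rw [eq_toTensor_add_shiftToTensor x Y h t]
  rw [map_add, map_add, d_toTensor x Y h, d_shiftToTensor x Y hk h, ofTensorShift_toTensor_apply,
    map_sub, map_smul, ofTensorShift_toTensor_apply, ofTensorShift_shiftToTensor_apply,
    smul_zero, zero_add, zero_sub]

end KoszulElements

/-! ### The homology sequence of `K(x) ⊗ Y` -/

section CycleClass

variable (Y Z : RComplex R) (i j k : ℤ)

/-- The homology class of a cycle of degree `j`, computed in `Y_i → Y_j → Y_k`. -/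
noncomputable def cycleClass :
    LinearMap.ker (Y.d j k).hom →ₗ[R] (Y.sc' i j k).homology :=
  (Y.sc' i j k).homologyClass

variable {i j k}

lemma exists_eq_cycleClass (c : (Y.sc' i j k).homology) :
    ∃ (y : Y.X j) (hy : (Y.d j k).hom y = 0), c = cycleClass Y i j k ⟨y, hy⟩ := by
  obtain ⟨⟨y, hy⟩, rfl⟩ := (Y.sc' i j k).homologyClass_surjective c
  exact ⟨y, hy, rfl⟩

lemma cycleClass_eq_zero_iff (y : LinearMap.ker (Y.d j k).hom) :
    cycleClass Y i j k y = 0 ↔ ∃ u : Y.X i, (Y.d i j).hom u = y.1 :=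
  (Y.sc' i j k).homologyClass_eq_zero_iff y

variable {Y Z} in
lemma homologyMap_cycleClass {i' j' k' : ℤ} (φ : Y.sc' i j k ⟶ Z.sc' i' j' k') (y : Y.X j)
    (z : Z.X j') (hy : (Y.d j k).hom y = 0) (hz : (Z.d j' k').hom z = 0)
    (h : (φ.τ₂ : Y.X j ⟶ Z.X j').hom y = z) :
    (ShortComplex.homologyMap φ).hom (cycleClass Y i j k ⟨y, hy⟩) =
      cycleClass Z i' j' k' ⟨z, hz⟩ :=
  ShortComplex.homologyMap_homologyClass φ _ _ h

end CycleClass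

section Sequence

variable (x : R) (Y : RComplex R)

/-- The map induced by `Y ⟶ K(x) ⊗ Y` on three consecutive terms. -/
noncomputable def toTensorSc {i j k : ℤ} (hij : 1 + j = i) (hjk : 1 + k = j) :
    Y.sc' i j k ⟶ (koszulOne x ⊗ Y).sc' i j k where
  τ₁ := toTensor x Y i
  τ₂ := toTensor x Y j
  τ₃ := toTensor x Y k
  comm₁₂ := toTensor_d x Y i j (by lia)
  comm₂₃ := toTensor_d x Y j k (by lia)

/-- The map of degree `-1` induced by the projection `K(x) ⊗ Y ⟶ Y` on three consecutive terms;
the sign in the outer terms makes up for the sign in the differential of the shifted copy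
of `Y`. -/
noncomputable def ofTensorShiftSc {i j k l : ℤ} (hij : 1 + j = i) (hjk : 1 + k = j)
    (hkl : 1 + l = k) : (koszulOne x ⊗ Y).sc' i j k ⟶ Y.sc' j k l where
  τ₁ := - ofTensorShift x Y j i hij
  τ₂ := ofTensorShift x Y k j hjk
  τ₃ := - ofTensorShift x Y l k hkl
  comm₁₂ := by
    refine ModuleCat.hom_ext (LinearMap.ext fun t => ?_)
    exact (map_neg (Y.d j k).hom _).trans (ofTensorShift_d x Y hjk hij t).symm
  comm₂₃ := by
    refine ModuleCat.hom_ext (LinearMap.ext fun t => ?_)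
    exact (neg_eq_iff_eq_neg.2 (ofTensorShift_d x Y hkl hjk t)).symm

variable {i j k l : ℤ} (hij : 1 + j = i) (hjk : 1 + k = j) (hkl : 1 + l = k)

include hjk in
lemma d_toTensor_eq_zero {y : Y.X j} (hy : (Y.d j k).hom y = 0) :
    ((koszulOne x ⊗ Y).d j k).hom ((toTensor x Y j).hom y) = 0 := by
  rw [d_toTensor x Y hjk, hy, map_zero]

lemma homologyMap_toTensorSc {y : Y.X j} (hy : (Y.d j k).hom y = 0) :
    (ShortComplex.homologyMap (toTensorSc x Y hij hjk)).hom (cycleClass Y i j k ⟨y, hy⟩) =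
      cycleClass (koszulOne x ⊗ Y) i j k
        ⟨(toTensor x Y j).hom y, d_toTensor_eq_zero x Y hjk hy⟩ :=
  homologyMap_cycleClass _ _ _ _ _ rfl

/-- The homology sequence `H_j(Y) → H_j(K(x) ⊗ Y) → H_{j-1}(Y)` is exact. -/
lemma exact_homology_koszulOne :
    Function.Exact (ShortComplex.homologyMap (toTensorSc x Y hij hjk)).hom
      (ShortComplex.homologyMap (ofTensorShiftSc x Y hij hjk hkl)).hom := by
  intro c
  constructor
  · intro hc
    obtain ⟨t, ht, rfl⟩ := exists_eq_cycleClass _ c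
    have hq : (Y.d k l).hom ((ofTensorShift x Y k j hjk).hom t) = 0 := by
      rw [← neg_eq_zero, ← ofTensorShift_d x Y hkl hjk, ht, map_zero]
    rw [homologyMap_cycleClass _ _ _ _ hq rfl, cycleClass_eq_zero_iff] at hc
    obtain ⟨u, hu⟩ := hc
    have hz : (Y.d j k).hom ((ofTensor x Y j).hom t + x • u) = 0 := by
      rw [map_add, map_smul, hu, ← ofTensor_d x Y hjk, ht, map_zero]
    refine ⟨cycleClass Y i j k ⟨_, hz⟩, ?_⟩
    rw [homologyMap_toTensorSc, ← sub_eq_zero, ← map_sub, cycleClass_eq_zero_iff]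
    -- The two cycles differ by the boundary of the copy of `u` in the shifted summand.
    refine ⟨(shiftToTensor x Y j i hij).hom u, ?_⟩
    change _ = (toTensor x Y j).hom ((ofTensor x Y j).hom t + x • u) - t
    conv_rhs => enter [2]; rw [eq_toTensor_add_shiftToTensor x Y hjk t]
    rw [d_shiftToTensor x Y hjk hij, hu, map_add, map_smul]
    abel
  · rintro ⟨c, rfl⟩
    obtain ⟨y, hy, rfl⟩ := exists_eq_cycleClass _ c
    rw [homologyMap_toTensorSc, homologyMap_cycleClass _ _ 0 _ (map_zero _)
      (ofTensorShift_toTensor_apply x Y hjk y)]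
    exact map_zero _

include hij hjk in
/-- Multiplication by `x` is null-homotopic on `K(x) ⊗ Y`. -/
lemma smul_homology_koszulOne (c : ((koszulOne x ⊗ Y).sc' i j k).homology) : x • c = 0 := by
  obtain ⟨t, ht, rfl⟩ := exists_eq_cycleClass _ c
  rw [← map_smul, cycleClass_eq_zero_iff]
  have hd : (Y.d j k).hom ((ofTensor x Y j).hom t) =
      - (x • (ofTensorShift x Y k j hjk).hom t) := by
    rw [eq_neg_iff_add_eq_zero, ← ofTensor_d x Y hjk, ht, map_zero]
  refine ⟨(shiftToTensor x Y j i hij).hom ((ofTensor x Y j).hom t), ?_⟩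
  rw [d_shiftToTensor x Y hjk hij, hd, map_neg, map_smul, sub_neg_eq_add, ← smul_add,
    ← eq_toTensor_add_shiftToTensor]
  rfl

/-- The kernel of `H_j(Y) → H_j(K(x) ⊗ Y)` is `x H_j(Y)`. -/
lemma homologyMap_toTensorSc_eq_zero_iff (c : (Y.sc' i j k).homology) :
    (ShortComplex.homologyMap (toTensorSc x Y hij hjk)).hom c = 0 ↔
      ∃ c' : (Y.sc' i j k).homology, x • c' = c := by
  constructor
  · intro hc
    obtain ⟨y, hy, rfl⟩ := exists_eq_cycleClass _ c
    rw [homologyMap_toTensorSc, cycleClass_eq_zero_iff] at hc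
    obtain ⟨t, ht⟩ := hc
    change ((koszulOne x ⊗ Y).d i j).hom t = (toTensor x Y j).hom y at ht
    have hq : (Y.d j k).hom ((ofTensorShift x Y j i hij).hom t) = 0 := by
      rw [← neg_eq_zero, ← ofTensorShift_d x Y hjk hij, ht, ofTensorShift_toTensor_apply]
    refine ⟨cycleClass Y i j k ⟨_, hq⟩, ?_⟩
    rw [← map_smul, eq_comm, ← sub_eq_zero, ← map_sub, cycleClass_eq_zero_iff]
    refine ⟨(ofTensor x Y i).hom t, ?_⟩
    change _ = y - x • (ofTensorShift x Y j i hij).hom t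
    rw [eq_sub_iff_add_eq, ← ofTensor_d, ht, ofTensor_toTensor_apply]
  · rintro ⟨c, rfl⟩
    rw [map_smul, smul_homology_koszulOne x Y hij hjk]

end Sequence

end RComplex

/-! ### Complexes supported on their bottom homology -/

namespace RComplex
variable {R : Type u} [CommRing R]

/-- The homology of a complex, computed from three consecutive terms. -/
noncomputable def homologyEquiv (Y : RComplex R) {i j k : ℤ} (hij : 1 + j = i) (hjk : 1 + k = j) :
    Y.homology j ≃ₗ[R] (Y.sc' i j k).homology :=
  (ShortComplex.homologyMapIso (Y.isoSc' i j k (by rw [ChainComplex.prev]; lia)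
    (by rw [ChainComplex.next]; lia))).toLinearEquiv

/-- The homology modules of `Y` are finitely generated and vanish in negative degrees, the bottom
one `H₀(Y)` is isomorphic to `R/J`, and each element of `J` is nilpotent on every `H_i(Y)`. So the
whole homology is supported where `H₀(Y)` is, in `V(J)`. Nilpotence, rather than `J H_i(Y) = 0`, is
what passes through the extensions in the homology sequence of `K(x) ⊗ Y`. -/
structure HasCyclicBottom (Y : RComplex R) (J : Ideal R) : Prop where
  finite : ∀ i, Module.Finite R (Y.homology i)
  subsingleton_of_neg : ∀ i < 0, Subsingleton (Y.homology i)
  exists_surjective : ∃ f : R →ₗ[R] Y.homology 0, Function.Surjective f ∧ LinearMap.ker f = J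
  le_radical : ∀ i, J ≤ (Module.annihilator R (Y.homology i)).radical

namespace HasCyclicBottom

variable {Y Z : RComplex R} {J : Ideal R}

lemma of_linearEquiv (h : Y.HasCyclicBottom J) (e : ∀ i, Y.homology i ≃ₗ[R] Z.homology i) :
    Z.HasCyclicBottom J where
  finite i := have := h.finite i; Module.Finite.equiv (e i)
  subsingleton_of_neg i hi := have := h.subsingleton_of_neg i hi; (e i).symm.subsingleton
  exists_surjective := by
    obtain ⟨f, hf, hker⟩ := h.exists_surjective
    refine ⟨(e 0).toLinearMap ∘ₗ f, (e 0).surjective.comp hf, ?_⟩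
    rw [LinearEquiv.ker_comp, hker]
  le_radical i := by rw [← (e i).annihilator_eq]; exact h.le_radical i

lemma of_iso (h : Y.HasCyclicBottom J) (e : Y ≅ Z) : Z.HasCyclicBottom J :=
  h.of_linearEquiv fun i =>
    ((HomologicalComplex.homologyFunctor _ _ i).mapIso e).toLinearEquiv

/-- By the homology sequence, tensoring with `K(x)` replaces the bottom homology `R/J` by
`R/(J + xR)`, and keeps the other properties. -/
lemma koszulOne_tensor [IsNoetherianRing R] (h : Y.HasCyclicBottom J) (x : R) :
    (koszulOne x ⊗ Y).HasCyclicBottom (J ⊔ Ideal.span {x}) := by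
  have key (j : ℤ) : ∃ (f : Y.homology j →ₗ[R] (koszulOne x ⊗ Y).homology j)
      (g : (koszulOne x ⊗ Y).homology j →ₗ[R] Y.homology (j - 1)), Function.Exact f g ∧
      (∀ c, f c = 0 ↔ ∃ c', x • c' = c) := by
    have hij : 1 + j = 1 + j := rfl
    have hjk : 1 + (j - 1) = j := by lia
    have hkl : 1 + (j - 2) = j - 1 := by lia
    have hex := exact_homology_koszulOne x Y hij hjk hkl
    refine ⟨((koszulOne x ⊗ Y).homologyEquiv hij hjk).symm.toLinearMap ∘ₗ
      (ShortComplex.homologyMap (toTensorSc x Y hij hjk)).hom ∘ₗ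
      (Y.homologyEquiv hij hjk).toLinearMap, (Y.homologyEquiv hjk hkl).symm.toLinearMap ∘ₗ
      (ShortComplex.homologyMap (ofTensorShiftSc x Y hij hjk hkl)).hom ∘ₗ
      ((koszulOne x ⊗ Y).homologyEquiv hij hjk).toLinearMap, ?_, ?_⟩
    · intro c
      have := hex ((koszulOne x ⊗ Y).homologyEquiv hij hjk c)
      simp only [LinearMap.comp_apply, LinearEquiv.coe_coe, map_eq_zero_iff _
        (LinearEquiv.injective _), this, Set.mem_range, LinearEquiv.symm_apply_eq]
      exact ⟨fun ⟨y, hy⟩ => ⟨(Y.homologyEquiv hij hjk).symm y, by simpa using hy⟩,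
        fun ⟨y, hy⟩ => ⟨_, hy⟩⟩
    · intro c
      simp only [LinearMap.comp_apply, LinearEquiv.coe_coe, map_eq_zero_iff _
        (LinearEquiv.injective _), homologyMap_toTensorSc_eq_zero_iff]
      constructor
      · rintro ⟨c', hc'⟩
        refine ⟨(Y.homologyEquiv hij hjk).symm c', ?_⟩
        rw [← map_smul, hc', LinearEquiv.symm_apply_apply]
      · rintro ⟨c', rfl⟩
        exact ⟨Y.homologyEquiv hij hjk c', (map_smul _ _ _).symm⟩
  have hx (j : ℤ) (c : (koszulOne x ⊗ Y).homology j) : x • c = 0 := by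
    have hjk : 1 + (j - 1) = j := by lia
    apply ((koszulOne x ⊗ Y).homologyEquiv rfl hjk).injective
    rw [map_smul, map_zero, smul_homology_koszulOne x Y rfl hjk]
  refine ⟨fun j => ?_, fun j hj => ?_, ?_, fun j => sup_le (fun r hr => ?_) ?_⟩
  · obtain ⟨f, g, hfg, -⟩ := key j
    have := h.finite j
    have := h.finite (j - 1)
    have := isNoetherian_of_range_eq_ker f g (LinearMap.exact_iff.1 hfg).symm
    infer_instance
  · obtain ⟨f, g, hfg, -⟩ := key j
    have := h.subsingleton_of_neg j hj
    have := h.subsingleton_of_neg (j - 1) (by lia)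
    refine subsingleton_of_forall_eq 0 fun c => ?_
    obtain ⟨c', rfl⟩ := (hfg c).1 (Subsingleton.elim _ _)
    rw [Subsingleton.elim c' 0, map_zero]
  · obtain ⟨f, g, hfg, hf⟩ := key 0
    have := h.subsingleton_of_neg (0 - 1) (by lia)
    obtain ⟨p, hp, hker⟩ := h.exists_surjective
    have hsurj : Function.Surjective f := fun c => (hfg c).1 (Subsingleton.elim _ _)
    refine ⟨f ∘ₗ p, hsurj.comp hp, ?_⟩
    ext r
    rw [LinearMap.mem_ker, LinearMap.comp_apply, hf, Submodule.mem_sup, ← hker]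
    constructor
    · rintro ⟨c', hc'⟩
      obtain ⟨s, rfl⟩ := hp c'
      refine ⟨r - x * s, ?_, x * s, Ideal.mem_span_singleton'.2 ⟨s, mul_comm _ _⟩, by ring⟩
      rw [LinearMap.mem_ker, map_sub, ← hc', ← map_smul, smul_eq_mul, sub_self]
    · rintro ⟨a, ha, b, hb, rfl⟩
      obtain ⟨s, rfl⟩ := Ideal.mem_span_singleton'.1 hb
      refine ⟨p s, ?_⟩
      rw [map_add, LinearMap.mem_ker.1 ha, zero_add, ← map_smul, smul_eq_mul, mul_comm]
  · obtain ⟨f, g, hfg, -⟩ := key j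
    obtain ⟨m, hm⟩ := h.le_radical j hr
    obtain ⟨n, hn⟩ := h.le_radical (j - 1) hr
    rw [Module.mem_annihilator] at hm hn
    refine ⟨m + n, Module.mem_annihilator.2 fun c => ?_⟩
    have : g (r ^ n • c) = 0 := by rw [map_smul, hn]
    obtain ⟨c', hc'⟩ := (hfg _).1 this
    rw [pow_add, mul_smul, ← hc', ← map_smul, hm, map_zero]
  · rw [Ideal.span_singleton_le_iff_mem]
    exact Ideal.le_radical (Module.mem_annihilator.2 (hx j))

lemma koszulTensor [IsNoetherianRing R] (h : Y.HasCyclicBottom J) (xs : List R) :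
    (koszulTensor xs Y).HasCyclicBottom (J ⊔ Ideal.ofList xs) := by
  induction xs with
  | nil =>
    rw [Ideal.ofList_nil, sup_bot_eq]
    exact h.of_iso (λ_ Y).symm
  | cons x xs ih =>
    rw [Ideal.ofList_cons, sup_comm (Ideal.span {x}), ← sup_assoc]
    exact (ih.koszulOne_tensor x).of_iso (α_ (koszulOne x) (koszul xs) Y).symm

end HasCyclicBottom

end RComplex

/-! ### The homology of a DG algebra -/

section DGAlgebra

variable {A₀ : Type u} [CommRing A₀] {A : Type u} [Ring A] [Algebra A₀ A]
  {𝒜 : ℤ → Submodule A₀ A} [GradedAlgebra 𝒜] {d : A →ₗ[A₀] A}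

namespace IsDGAlgebra

variable (h : IsDGAlgebra 𝒜 d)

/-- The inclusion of the terms of the underlying complex in the algebra. -/
noncomputable def toComplexVal (i : ℤ) : h.toComplex.X i →ₗ[A₀] A := (𝒜 i).subtype

lemma toComplexVal_injective (i : ℤ) : Function.Injective (h.toComplexVal i) :=
  (𝒜 i).injective_subtype

lemma toComplexVal_mem {i : ℤ} (y : h.toComplex.X i) : h.toComplexVal i y ∈ 𝒜 i :=
  Submodule.coe_mem (p := 𝒜 i) y

lemma exists_toComplexVal_eq {i : ℤ} {a : A} (ha : a ∈ 𝒜 i) : ∃ y, h.toComplexVal i y = a :=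
  ⟨(⟨a, ha⟩ : 𝒜 i), rfl⟩

lemma toComplexVal_d {i j : ℤ} (hij : 1 + j = i) (y : h.toComplex.X i) :
    h.toComplexVal j ((h.toComplex.d i j).hom y) = d (h.toComplexVal i y) := by
  have hij' : j + 1 = i := by lia
  have : h.toComplex.d i j = _ := dif_pos hij'
  rw [this]
  rfl

lemma subsingleton_toComplex_X {i : ℤ} (hi : i < 0) : Subsingleton (h.toComplex.X i) := by
  refine subsingleton_of_forall_eq 0 fun y => h.toComplexVal_injective i ?_
  have := h.toComplexVal_mem y
  rw [h.eq_bot_of_neg i hi, Submodule.mem_bot] at this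
  rw [this, map_zero]

include h in
/-- If `r = ∂(a)` and `z` is a cycle, then `r z = ∂(a z)`. -/
lemma smul_eq_d_mul {i : ℤ} {r : A₀} {a z : A} (ha : a ∈ 𝒜 1) (hz : z ∈ 𝒜 i)
    (hr : d a = algebraMap A₀ A r) (hdz : d z = 0) : d (a * z) = r • z := by
  rw [h.leibniz ha hz, hr, hdz, mul_zero, smul_zero, add_zero, Algebra.smul_def]

lemma hasCyclicBottom_toComplex (hfin : ∀ i, Module.Finite A₀ (h.toComplex.homology i)) :
    h.toComplex.HasCyclicBottom (boundaryIdeal 𝒜 d) := by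
  refine ⟨hfin, fun i hi => ?_, ?_, fun i => le_trans (fun r hr => ?_) Ideal.le_radical⟩
  · refine subsingleton_of_forall_eq 0 fun c => ?_
    have hjk : 1 + (i - 1) = i := by lia
    have := h.subsingleton_toComplex_X hi
    apply (h.toComplex.homologyEquiv rfl hjk).injective
    obtain ⟨y, hy, hc⟩ :=
      RComplex.exists_eq_cycleClass _ ((h.toComplex.homologyEquiv rfl hjk) c)
    rw [hc, map_zero, RComplex.cycleClass_eq_zero_iff]
    exact ⟨0, Subsingleton.elim _ _⟩
  · have h1 : (1 : ℤ) + 0 = 1 := rfl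
    have h0 : (1 : ℤ) + (-1) = 0 := rfl
    have := h.subsingleton_toComplex_X (i := -1) (by decide)
    let e : A₀ →ₗ[A₀] h.toComplex.X 0 := (Algebra.linearMap A₀ A).codRestrict (𝒜 0) fun r => by
      rw [Algebra.linearMap_apply, Algebra.algebraMap_eq_smul_one]
      exact (𝒜 0).smul_mem r SetLike.GradedOne.one_mem
    have he (r : A₀) : h.toComplexVal 0 (e r) = algebraMap A₀ A r := rfl
    let g : A₀ →ₗ[A₀] LinearMap.ker (h.toComplex.d 0 (-1)).hom :=
      e.codRestrict _ fun r => Subsingleton.elim _ _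
    have hg : Function.Surjective (RComplex.cycleClass h.toComplex 1 0 (-1) ∘ₗ g) := by
      intro c
      obtain ⟨y, hy, rfl⟩ := RComplex.exists_eq_cycleClass _ c
      obtain ⟨r, hr⟩ := h.exists_algebraMap_eq _ (h.toComplexVal_mem y)
      exact ⟨r, congrArg (RComplex.cycleClass _ 1 0 (-1))
        (Subtype.ext (h.toComplexVal_injective 0 ((he r).trans hr)))⟩
    refine ⟨(h.toComplex.homologyEquiv h1 h0).symm.toLinearMap ∘ₗ
      RComplex.cycleClass h.toComplex 1 0 (-1) ∘ₗ g,
      (h.toComplex.homologyEquiv h1 h0).symm.surjective.comp hg, ?_⟩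
    ext r
    rw [LinearEquiv.ker_comp, LinearMap.mem_ker, LinearMap.comp_apply,
      RComplex.cycleClass_eq_zero_iff]
    constructor
    · rintro ⟨u, hu⟩
      refine ⟨h.toComplexVal 1 u, h.toComplexVal_mem u, ?_⟩
      rw [← h.toComplexVal_d h1, hu]
      rfl
    · rintro ⟨a, ha, hr⟩
      obtain ⟨u, rfl⟩ := h.exists_toComplexVal_eq ha
      exact ⟨u, h.toComplexVal_injective 0 ((h.toComplexVal_d h1 u).trans hr)⟩
  · obtain ⟨a, ha, hr⟩ := hr
    refine Module.mem_annihilator.2 fun c => ?_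
    have hjk : 1 + (i - 1) = i := by lia
    apply (h.toComplex.homologyEquiv rfl hjk).injective
    obtain ⟨z, hz, hc⟩ :=
      RComplex.exists_eq_cycleClass _ ((h.toComplex.homologyEquiv rfl hjk) c)
    rw [map_smul, hc, map_zero, ← map_smul, RComplex.cycleClass_eq_zero_iff]
    have hdz : d (h.toComplexVal i z) = 0 := by rw [← h.toComplexVal_d hjk, hz, map_zero]
    obtain ⟨u, hu⟩ := h.exists_toComplexVal_eq
      (SetLike.mul_mem_graded ha (h.toComplexVal_mem z) : a * h.toComplexVal i z ∈ 𝒜 (1 + i))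
    refine ⟨u, h.toComplexVal_injective i ?_⟩
    rw [h.toComplexVal_d rfl, hu, h.smul_eq_d_mul ha (h.toComplexVal_mem z) hr hdz]
    exact (map_smul (h.toComplexVal i) r z).symm

end IsDGAlgebra

end DGAlgebra

lemma dimToEReal_natCast (n : ℕ) : dimToEReal n = (n : EReal) := by
  change ((((n : ℕ∞) : ENNReal)) : EReal) = (n : EReal)
  rw [ENat.toENNReal_coe]
  rfl

section KrullDimension

variable {R : Type*} [CommRing R] [IsLocalRing R] [IsNoetherianRing R]

lemma exists_ringKrullDim_quotient_eq_natCast {J : Ideal R} (hJ : J ≠ ⊤) :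
    ∃ n : ℕ, ringKrullDim (R ⧸ J) = n := by
  have : Nontrivial (R ⧸ J) := Ideal.Quotient.nontrivial_iff.2 hJ
  have : FiniteRingKrullDim (R ⧸ J) := by
    refine Order.finiteDimensionalOrder_iff_krullDim_ne_bot_and_top.2 ⟨?_, ?_⟩
    · exact Order.krullDim_ne_bot_iff.2 inferInstance
    · exact ((ringKrullDim_le_of_surjective _ (Ideal.Quotient.mk_surjective (I := J))).trans_lt
        ringKrullDim_lt_top).ne
  exact ⟨_, Order.krullDim_eq_length_of_finiteDimensionalOrder⟩

/-- The dimension of `R/J` is attained at the prime which starts a longest chain in `V(J)`. -/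
lemma exists_isPrime_ringKrullDim_quotient_eq {J : Ideal R} (hJ : J ≠ ⊤) :
    ∃ p : PrimeSpectrum R, J ≤ p.asIdeal ∧ ringKrullDim (R ⧸ p.asIdeal) = ringKrullDim (R ⧸ J) := by
  obtain ⟨n, hn⟩ := exists_ringKrullDim_quotient_eq_natCast hJ
  have hn' := hn
  rw [ringKrullDim_quotient] at hn'
  have hne : Nonempty (PrimeSpectrum.zeroLocus (J : Set R)) := by
    rw [← Order.krullDim_ne_bot_iff, hn']
    exact WithBot.coe_ne_bot
  have : FiniteDimensionalOrder (PrimeSpectrum.zeroLocus (J : Set R)) :=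
    Order.finiteDimensionalOrder_iff_krullDim_ne_bot_and_top.2
      ⟨Order.krullDim_ne_bot_iff.2 hne, by rw [hn']; exact fun h => by cases h⟩
  let s := LTSeries.longestOf (PrimeSpectrum.zeroLocus (J : Set R))
  refine ⟨s.head.1, s.head.2, le_antisymm ?_ ?_⟩
  · exact ringKrullDim_le_of_surjective (Ideal.Quotient.factor s.head.2)
      (Ideal.Quotient.factor_surjective _)
  · rw [ringKrullDim_quotient, Order.krullDim_eq_length_of_finiteDimensionalOrder,
      ringKrullDim_quotient]
    let t : LTSeries (PrimeSpectrum.zeroLocus (s.head.1.asIdeal : Set R)) :=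
      { length := s.length
        toFun := fun i => ⟨(s i).1, s.head_le i⟩
        step := fun i => s.step i }
    exact Order.LTSeries.length_le_krullDim t

end KrullDimension

/-! ### Localization, dimension and anchor primes -/

namespace RComplex.HasCyclicBottom

variable {R : Type u} [CommRing R] {Y : RComplex R} {J : Ideal R}

lemma localizedAt (h : Y.HasCyclicBottom J) (p : PrimeSpectrum R) :
    (Y.localizedAt p).HasCyclicBottom
      (J.map (algebraMap R (Localization p.asIdeal.primeCompl))) := by
  let S := p.asIdeal.primeCompl
  have e (i : ℤ) : (Y.localizedAt p).homology i ≃ₗ[Localization S]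
      (Y.homology i).localizedModule S :=
    ((Y.sc i).mapHomologyIso (ModuleCat.localizedModuleFunctor.{u} S)).toLinearEquiv
  refine ⟨fun i => ?_, fun i hi => ?_, ?_, fun i => ?_⟩
  · have := h.finite i
    have : Module.Finite (Localization S) ((Y.homology i).localizedModule S) :=
      Module.Finite.of_isLocalizedModule S ((Y.homology i).localizedModuleMkLinearMap S)
    exact Module.Finite.equiv (e i).symm
  · have := h.subsingleton_of_neg i hi
    have : Subsingleton ((Y.homology i).localizedModule S) := by
      refine subsingleton_of_forall_eq 0 fun c => ?_
      obtain ⟨⟨m, s⟩, rfl⟩ := IsLocalizedModule.mk'_surjective S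
        ((Y.homology i).localizedModuleMkLinearMap S) c
      rw [Subsingleton.elim m 0]
      exact IsLocalizedModule.mk'_zero _ _
    exact (e i).subsingleton
  · obtain ⟨f, hf, hker⟩ := h.exists_surjective
    let ι := (Y.homology 0).localizedModuleMkLinearMap S
    let g : Localization S →ₗ[Localization S] (Y.homology 0).localizedModule S :=
      LinearMap.toSpanSingleton _ _ (ι (f 1))
    have hg (r : R) : g (algebraMap R _ r) = ι (f r) := by
      rw [LinearMap.toSpanSingleton_apply, algebraMap_smul, ← map_smul, ← map_smul, smul_eq_mul,
        mul_one]
    have hunit (s : S) : IsUnit (algebraMap R (Localization S) s) :=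
      IsLocalization.map_units _ s
    refine ⟨(e 0).symm.toLinearMap ∘ₗ g, (e 0).symm.surjective.comp fun c => ?_, ?_⟩
    · obtain ⟨⟨m, s⟩, rfl⟩ := IsLocalizedModule.mk'_surjective S ι c
      obtain ⟨r, rfl⟩ := hf m
      refine ⟨IsLocalization.mk' _ r s, ?_⟩
      refine (IsLocalizedModule.smul_injective ι s) ?_
      change s • g _ = s • IsLocalizedModule.mk' ι (f r) s
      rw [IsLocalizedModule.mk'_cancel', ← hg, Submonoid.smul_def, ← algebraMap_smul
        (Localization S), ← map_smul, smul_eq_mul, IsLocalization.mk'_spec']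
    · rw [LinearEquiv.ker_comp]
      ext c
      obtain ⟨r, s, rfl⟩ := IsLocalization.exists_mk'_eq S c
      have : g (IsLocalization.mk' _ r s) = 0 ↔ ι (f r) = 0 := by
        rw [← hg, ← IsLocalization.mk'_spec' (Localization S) r s, ← smul_eq_mul, map_smul,
          (hunit s).smul_eq_zero]
      rw [LinearMap.mem_ker, this, IsLocalizedModule.eq_zero_iff S,
        IsLocalization.mk'_mem_map_algebraMap_iff]
      refine ⟨fun ⟨t, ht⟩ => ⟨t, t.2, ?_⟩, fun ⟨t, ht, htr⟩ => ⟨⟨t, ht⟩, ?_⟩⟩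
      · rw [← hker, LinearMap.mem_ker, ← smul_eq_mul, map_smul]
        exact ht
      · rw [← hker, LinearMap.mem_ker, ← smul_eq_mul, map_smul] at htr
        exact htr
  · rw [(e i).annihilator_eq, Ideal.map_le_iff_le_comap]
    intro r hr
    obtain ⟨n, hn⟩ := h.le_radical i hr
    refine ⟨n, Module.mem_annihilator.2 fun c => ?_⟩
    obtain ⟨⟨m, s⟩, rfl⟩ := IsLocalizedModule.mk'_surjective S
      ((Y.homology i).localizedModuleMkLinearMap S) c
    rw [← map_pow, algebraMap_smul]
    change r ^ n • IsLocalizedModule.mk' _ m s = 0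
    rw [← IsLocalizedModule.mk'_smul, Module.mem_annihilator.1 hn, IsLocalizedModule.mk'_zero]

/-- The bottom homology module is `R/J`. -/
lemma nonempty_linearEquiv (h : Y.HasCyclicBottom J) :
    Nonempty ((R ⧸ J) ≃ₗ[R] Y.homology 0) := by
  obtain ⟨f, hf, rfl⟩ := h.exists_surjective
  exact ⟨f.quotKerEquivOfSurjective hf⟩

lemma mem_supp_iff (h : Y.HasCyclicBottom J) (p : PrimeSpectrum R) :
    p ∈ Y.supp ↔ J ≤ p.asIdeal := by
  obtain ⟨e⟩ := h.nonempty_linearEquiv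
  refine ⟨fun hp => ?_, fun hp => Set.mem_iUnion.2 ⟨0, ?_⟩⟩
  · obtain ⟨i, hi⟩ := Set.mem_iUnion.1 hp
    have := Ideal.radical_mono (Module.annihilator_le_of_mem_support hi)
    rw [p.isPrime.radical] at this
    exact (h.le_radical i).trans this
  · have := h.finite 0
    rwa [Module.mem_support_iff_of_finite, ← e.annihilator_eq, Ideal.annihilator_quotient]

lemma inf_eq_zero (h : Y.HasCyclicBottom J) (hJ : J ≠ ⊤) : Y.inf = 0 := by
  obtain ⟨e⟩ := h.nonempty_linearEquiv
  have : Nontrivial (R ⧸ J) := Ideal.Quotient.nontrivial_iff.2 hJ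
  refine le_antisymm ((iInf₂_le (0 : ℤ) e.symm.toEquiv.nontrivial).trans (by simp))
    (le_iInf₂ fun i hi => ?_)
  have : 0 ≤ i := by
    by_contra! hneg
    exact not_subsingleton _ (h.subsingleton_of_neg i hneg)
  exact_mod_cast this

lemma inf_localizedAt_eq_zero (h : Y.HasCyclicBottom J) {p : PrimeSpectrum R}
    (hp : J ≤ p.asIdeal) : (Y.localizedAt p).inf = 0 := by
  refine (h.localizedAt p).inf_eq_zero fun htop => ?_
  have := (IsLocalization.map_algebraMap_ne_top_iff_disjoint p.asIdeal.primeCompl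
    (Localization p.asIdeal.primeCompl) J).2
    (Set.disjoint_left.2 fun x hx hxJ => hx (hp hxJ))
  exact this htop

/-- All localizations at primes in the support have infimum `0`, so the dimension of the complex is
the supremum of the `dim R/p` with `p ∈ V(J)`. -/
lemma dim_eq [IsLocalRing R] [IsNoetherianRing R] (h : Y.HasCyclicBottom J) (hJ : J ≠ ⊤) :
    Y.dim = dimToEReal (ringKrullDim (R ⧸ J)) := by
  have key (p : PrimeSpectrum R) (hp : J ≤ p.asIdeal) :
      dimToEReal (ringKrullDim (R ⧸ p.asIdeal)) - (Y.localizedAt p).inf =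
        dimToEReal (ringKrullDim (R ⧸ p.asIdeal)) := by
    rw [h.inf_localizedAt_eq_zero hp, sub_zero]
  refine le_antisymm (iSup₂_le fun p hp => ?_) ?_
  · rw [h.mem_supp_iff] at hp
    rw [key p hp]
    obtain ⟨n, hn⟩ := exists_ringKrullDim_quotient_eq_natCast hJ
    obtain ⟨m, hm⟩ := exists_ringKrullDim_quotient_eq_natCast p.isPrime.ne_top
    have := ringKrullDim_le_of_surjective (Ideal.Quotient.factor hp)
      (Ideal.Quotient.factor_surjective hp)
    rw [hn, hm] at this
    rw [hn, hm, dimToEReal_natCast, dimToEReal_natCast]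
    exact_mod_cast this
  · obtain ⟨p, hp, hdim⟩ := exists_isPrime_ringKrullDim_quotient_eq hJ
    rw [← hdim, ← key p hp]
    exact le_iSup₂ (f := fun (p : PrimeSpectrum R) (_ : p ∈ Y.supp) =>
      dimToEReal (ringKrullDim (R ⧸ p.asIdeal)) - (Y.localizedAt p).inf) p
      ((h.mem_supp_iff p).2 hp)

lemma isAnchor_closedPoint_iff [IsLocalRing R] [IsNoetherianRing R] (h : Y.HasCyclicBottom J)
    (hJ : J ≠ ⊤) :
    Y.IsAnchor (IsLocalRing.closedPoint R) ↔ ringKrullDim (R ⧸ J) = 0 := by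
  have hle : J ≤ (IsLocalRing.closedPoint R).asIdeal := IsLocalRing.le_maximalIdeal hJ
  let S := (IsLocalRing.closedPoint R).asIdeal.primeCompl
  -- Localizing a local ring at its maximal ideal does not change it.
  let e : R ≃+* Localization S := (IsLocalization.atUnits R S fun x hx => by
    by_contra hx'
    exact hx ((IsLocalRing.mem_maximalIdeal x).2 hx')).toRingEquiv
  have hmap : J.map (algebraMap R (Localization S)) = J.map (e : R →+* Localization S) := by
    congr 1
  let e' := Ideal.quotientEquiv J (J.map (algebraMap R (Localization S))) e hmap
  have : IsLocalRing (Localization S) :=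
    Localization.AtPrime.isLocalRing (IsLocalRing.closedPoint R).asIdeal
  have hJS : J.map (algebraMap R (Localization S)) ≠ ⊤ := by
    have := Ideal.Quotient.nontrivial_iff.2 hJ
    exact Ideal.Quotient.nontrivial_iff.1 e'.symm.toEquiv.nontrivial
  rw [IsAnchor, h.mem_supp_iff, h.inf_localizedAt_eq_zero hle, (h.localizedAt _).dim_eq hJS,
    ← ringKrullDim_eq_of_ringEquiv e', and_iff_right hle, neg_zero]
  obtain ⟨n, hn⟩ := exists_ringKrullDim_quotient_eq_natCast hJ
  rw [hn, dimToEReal_natCast]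
  norm_cast

end RComplex.HasCyclicBottom

/-! ### Finite length and systems of parameters -/

section LocalAlgebra

variable {R : Type*} [CommRing R]

lemma Ideal.ofList_le_iff {xs : List R} {I : Ideal R} : Ideal.ofList xs ≤ I ↔ ∀ x ∈ xs, x ∈ I :=
  Ideal.span_le

lemma isFiniteLength_quotient_iff [IsNoetherianRing R] {J : Ideal R} (hJ : J ≠ ⊤) :
    IsFiniteLength R (R ⧸ J) ↔ ringKrullDim (R ⧸ J) = 0 := by
  have := Ideal.Quotient.nontrivial_iff.2 hJ
  rw [← ringKrullDimZero_iff_ringKrullDim_eq_zero, ← isArtinianRing_iff_krullDimLE_zero,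
    isFiniteLength_iff_isNoetherian_isArtinian]
  refine ⟨fun h => ?_, fun h => ⟨inferInstance, ?_⟩⟩
  · have := h.2
    exact isArtinian_of_tower R h.2
  · have : IsArtinian (R ⧸ J) (R ⧸ J) := h
    exact isArtinian_of_surjective_algebraMap (R := R ⧸ J) Ideal.Quotient.mk_surjective

/-- A finitely generated module over a noetherian ring has finite length if it is supported in
`V(J)` with `R/J` of dimension zero. -/
lemma isFiniteLength_of_le_radical_annihilator [IsNoetherianRing R] {J : Ideal R}
    (hJ : Ring.KrullDimLE 0 (R ⧸ J)) (M : Type*) [AddCommGroup M] [Module R M]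
    [Module.Finite R M] (hM : J ≤ (Module.annihilator R M).radical) : IsFiniteLength R M := by
  have hdim : Ring.KrullDimLE 0 (R ⧸ Module.annihilator R M) := by
    rw [Ring.krullDimLE_zero_iff] at hJ ⊢
    intro P hP
    have hQ : J ≤ P.comap (Ideal.Quotient.mk (Module.annihilator R M)) := by
      refine hM.trans ((Ideal.IsPrime.radical_le_iff inferInstance).2 fun r hr => ?_)
      rw [Ideal.mem_comap, Ideal.Quotient.eq_zero_iff_mem.2 hr]
      exact P.zero_mem
    have hmax := hJ ((P.comap (Ideal.Quotient.mk (Module.annihilator R M))).map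
      (Ideal.Quotient.mk J)) (Ideal.map_isPrime_of_surjective Ideal.Quotient.mk_surjective
        (by rwa [Ideal.mk_ker]))
    have hmax' := Ideal.comap_isMaximal_of_surjective (Ideal.Quotient.mk J)
      Ideal.Quotient.mk_surjective (K := (P.comap (Ideal.Quotient.mk
        (Module.annihilator R M))).map (Ideal.Quotient.mk J))
    rw [Ideal.comap_map_of_surjective _ Ideal.Quotient.mk_surjective, ← RingHom.ker_eq_comap_bot,
      Ideal.mk_ker, sup_eq_left.2 hQ] at hmax'
    rw [← Ideal.map_comap_of_surjective _ Ideal.Quotient.mk_surjective P]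
    exact (Ideal.map_eq_top_or_isMaximal_of_surjective _ Ideal.Quotient.mk_surjective
      hmax').resolve_left (by
        rw [Ideal.map_comap_of_surjective _ Ideal.Quotient.mk_surjective]; exact hP.ne_top)
  let _ := Module.quotientAnnihilator (R := R) (M := M)
  have htower : IsScalarTower R (R ⧸ Module.annihilator R M) M := inferInstance
  have : IsArtinianRing (R ⧸ Module.annihilator R M) := isArtinianRing_iff_krullDimLE_zero.2 hdim
  have : Module.Finite (R ⧸ Module.annihilator R M) M :=
    Module.Finite.of_restrictScalars_finite R _ _
  rw [isFiniteLength_iff_isNoetherian_isArtinian]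
  exact ⟨inferInstance, isArtinian_of_surjective_algebraMap
    (R := R ⧸ Module.annihilator R M) Ideal.Quotient.mk_surjective⟩

/-- `(R/J)/I(R/J)` is `R/(J + I)`, as a module. -/
lemma nonempty_quotient_smul_top_equiv (I J : Ideal R) :
    Nonempty (((R ⧸ J) ⧸ (I • (⊤ : Submodule R (R ⧸ J)))) ≃ₗ[R] (R ⧸ (J ⊔ I))) := by
  let f := (I • (⊤ : Submodule R (R ⧸ J))).mkQ ∘ₗ J.mkQ
  have hf : Function.Surjective f := (Submodule.mkQ_surjective _).comp (Submodule.mkQ_surjective _)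
  have hker : LinearMap.ker f = J ⊔ I := by
    rw [LinearMap.ker_comp, Submodule.ker_mkQ, ← Submodule.range_mkQ J, ← Submodule.map_top,
      ← Submodule.map_smul'', smul_eq_mul, Ideal.mul_top, Submodule.comap_map_mkQ]
  exact ⟨(f.quotKerEquivOfSurjective hf).symm.trans (Submodule.quotEquivOfEq _ _ hker)⟩

variable [IsLocalRing R] [IsNoetherianRing R]

lemma ringKrullDim_quotient_le_add_length {J : Ideal R} (hJ : J ≠ ⊤) {xs : List R}
    (hxs : ∀ x ∈ xs, x ∈ IsLocalRing.maximalIdeal R) :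
    ringKrullDim (R ⧸ J) ≤ ringKrullDim (R ⧸ (J ⊔ Ideal.ofList xs)) + xs.length := by
  classical
  have := Ideal.Quotient.nontrivial_iff.2 hJ
  have : IsLocalRing (R ⧸ J) := .of_surjective' _ Ideal.Quotient.mk_surjective
  have : IsLocalHom (Ideal.Quotient.mk J) := IsLocalHom.of_surjective _ Ideal.Quotient.mk_surjective
  let s : Finset (R ⧸ J) := (xs.map (Ideal.Quotient.mk J)).toFinset
  have hs : Ideal.span (s : Set (R ⧸ J)) = (Ideal.ofList xs).map (Ideal.Quotient.mk J) := by
    rw [Ideal.map_ofList]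
    exact congrArg Ideal.span (by ext; simp [s])
  refine (ringKrullDim_le_ringKrullDim_quotient_add_card s ?_).trans ?_
  · rw [IsLocalRing.ringJacobson_eq_maximalIdeal]
    intro y hy
    obtain ⟨x, hx, rfl⟩ : ∃ x ∈ xs, Ideal.Quotient.mk J x = y := by simpa [s] using hy
    exact map_nonunit (Ideal.Quotient.mk J) x (hxs x hx)
  · rw [hs, ringKrullDim_eq_of_ringEquiv (DoubleQuot.quotQuotEquivQuotSup J (Ideal.ofList xs))]
    gcongr
    have := (xs.map (Ideal.Quotient.mk J)).toFinset_card_le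
    rw [List.length_map] at this
    exact_mod_cast this

/-- Systems of parameters of `R/J` exist, and lift to `R`. -/
lemma exists_list_ringKrullDim_quotient_sup_eq_zero {J : Ideal R} (hJ : J ≠ ⊤) :
    ∃ xs : List R, (∀ x ∈ xs, x ∈ IsLocalRing.maximalIdeal R) ∧
      ringKrullDim (R ⧸ (J ⊔ Ideal.ofList xs)) = 0 ∧
      (xs.length : WithBot ℕ∞) = ringKrullDim (R ⧸ J) := by
  have := Ideal.Quotient.nontrivial_iff.2 hJ
  have : IsLocalRing (R ⧸ J) := .of_surjective' _ Ideal.Quotient.mk_surjective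
  obtain ⟨s, hs, hcard⟩ := Ideal.exists_finset_card_eq_height_of_isNoetherianRing
    (IsLocalRing.maximalIdeal (R ⧸ J))
  let lift : R ⧸ J → R := Function.surjInv Ideal.Quotient.mk_surjective
  have hlift (y : R ⧸ J) : Ideal.Quotient.mk J (lift y) = y := Function.surjInv_eq _ y
  have hspan : (Ideal.ofList (s.toList.map lift)).map (Ideal.Quotient.mk J) =
      Ideal.span (s : Set (R ⧸ J)) := by
    rw [Ideal.map_ofList, List.map_map, show Ideal.Quotient.mk J ∘ lift = id from funext hlift,
      List.map_id]
    exact congrArg Ideal.span (by ext; simp)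
  refine ⟨s.toList.map lift, fun x hx => ?_, ?_, ?_⟩
  · obtain ⟨y, hy, rfl⟩ := List.mem_map.1 hx
    by_contra hunit
    have hu : IsUnit y := hlift y ▸ (not_not.1 hunit : IsUnit (lift y)).map (Ideal.Quotient.mk J)
    exact hs.1.2 (Ideal.subset_span (Finset.mem_toList.1 hy)) hu
  · rw [← ringKrullDim_eq_of_ringEquiv (DoubleQuot.quotQuotEquivQuotSup J _), hspan]
    have hart := IsLocalRing.quotient_artinian_of_mem_minimalPrimes_of_isLocalRing _ hs
    have : Nontrivial ((R ⧸ J) ⧸ Ideal.span (s : Set (R ⧸ J))) :=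
      Ideal.Quotient.nontrivial_iff.2 fun htop =>
        (IsLocalRing.maximalIdeal.isMaximal (R ⧸ J)).ne_top (top_le_iff.1 (htop ▸ hs.1.2))
    exact ringKrullDimZero_iff_ringKrullDim_eq_zero.1 (isArtinianRing_iff_krullDimLE_zero.1 hart)
  · rw [List.length_map, Finset.length_toList, ← IsLocalRing.maximalIdeal_height_eq_ringKrullDim,
      ← hcard]
    rfl

end LocalAlgebra

namespace RComplex.HasCyclicBottom

variable {R : Type u} [CommRing R] [IsLocalRing R] [IsNoetherianRing R] {Y : RComplex R}
  {J : Ideal R}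

/-- `K(xs) ⊗ Y` has homology supported in `V(J + (xs))` and bottom homology `R/(J + (xs))`, so all
its homology has finite length as soon as the bottom one has. -/
lemma isLengthSequence_iff (h : Y.HasCyclicBottom J) (hJ : J ≠ ⊤) {xs : List R}
    (hxs : ∀ x ∈ xs, x ∈ IsLocalRing.maximalIdeal R) :
    IsLengthSequence xs Y ↔ ringKrullDim (R ⧸ (J ⊔ Ideal.ofList xs)) = 0 := by
  have hne : J ⊔ Ideal.ofList xs ≠ ⊤ := ne_top_of_le_ne_top
    (IsLocalRing.maximalIdeal.isMaximal R).ne_top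
    (sup_le (IsLocalRing.le_maximalIdeal hJ) (Ideal.ofList_le_iff.2 hxs))
  have hK := h.koszulTensor xs
  rw [IsLengthSequence, and_iff_right hxs]
  refine ⟨fun hlen => ?_, fun hdim i => ?_⟩
  · obtain ⟨e⟩ := hK.nonempty_linearEquiv
    exact (isFiniteLength_quotient_iff hne).1 (e.symm.isFiniteLength (hlen 0))
  · have := Ideal.Quotient.nontrivial_iff.2 hne
    have := hK.finite i
    exact isFiniteLength_of_le_radical_annihilator
      (ringKrullDimZero_iff_ringKrullDim_eq_zero.2 hdim) _ (hK.le_radical i)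

lemma ldim_eq (h : Y.HasCyclicBottom J) (hJ : J ≠ ⊤) :
    Y.ldim = dimToEReal (ringKrullDim (R ⧸ J)) := by
  rw [ldim, h.inf_eq_zero hJ, sub_zero]
  obtain ⟨n, hn⟩ := exists_ringKrullDim_quotient_eq_natCast hJ
  rw [hn, dimToEReal_natCast]
  refine le_antisymm ?_ (le_iInf₂ fun xs hxs => ?_)
  · obtain ⟨xs, hxs, hdim, hlen⟩ := exists_list_ringKrullDim_quotient_sup_eq_zero hJ
    rw [hn] at hlen
    have hlen' : xs.length = n := by exact_mod_cast hlen
    rw [← hlen']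
    exact iInf₂_le xs ((h.isLengthSequence_iff hJ hxs).2 hdim)
  · have := ringKrullDim_quotient_le_add_length hJ hxs.1
    rw [(h.isLengthSequence_iff hJ hxs.1).1 hxs, hn, zero_add] at this
    exact_mod_cast this

/-- For a sequence in the maximal ideal, each of the three kinds of systems of parameters is
described by the same two conditions on `R/J`. -/
lemma tfae_systemOfParameters (h : Y.HasCyclicBottom J) (hJ : J ≠ ⊤) {xs : List R}
    (hxs : ∀ x ∈ xs, x ∈ IsLocalRing.maximalIdeal R) :
    List.TFAE [IsChristensenSOP xs Y, IsModuleSOP xs (R ⧸ J), IsLengthSOP xs Y] := by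
  have hne : J ⊔ Ideal.ofList xs ≠ ⊤ := ne_top_of_le_ne_top
    (IsLocalRing.maximalIdeal.isMaximal R).ne_top
    (sup_le (IsLocalRing.le_maximalIdeal hJ) (Ideal.ofList_le_iff.2 hxs))
  obtain ⟨n, hn⟩ := exists_ringKrullDim_quotient_eq_natCast hJ
  have h₁ : IsChristensenSOP xs Y ↔
      ringKrullDim (R ⧸ (J ⊔ Ideal.ofList xs)) = 0 ∧ xs.length = n := by
    rw [IsChristensenSOP, and_iff_right hxs, (h.koszulTensor xs).isAnchor_closedPoint_iff hne,
      h.dim_eq hJ, h.inf_eq_zero hJ, add_zero, hn, dimToEReal_natCast, EReal.natCast_eq_iff]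
  have h₂ : IsModuleSOP xs (R ⧸ J) ↔
      ringKrullDim (R ⧸ (J ⊔ Ideal.ofList xs)) = 0 ∧ xs.length = n := by
    obtain ⟨e⟩ := nonempty_quotient_smul_top_equiv (Ideal.ofList xs) J
    rw [IsModuleSOP, and_iff_right hxs, Module.supportDim_quotient_eq_ringKrullDim, hn,
      ← isFiniteLength_quotient_iff hne]
    refine and_congr ⟨e.isFiniteLength, e.symm.isFiniteLength⟩ ?_
    norm_cast
  have h₃ : IsLengthSOP xs Y ↔
      ringKrullDim (R ⧸ (J ⊔ Ideal.ofList xs)) = 0 ∧ xs.length = n := by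
    rw [IsLengthSOP, h.isLengthSequence_iff hJ hxs, h.ldim_eq hJ, h.inf_eq_zero hJ, add_zero, hn,
      dimToEReal_natCast, EReal.natCast_eq_iff]
  rw [h₁, h₂, h₃]
  tfae_have 1 ↔ 2 := Iff.rfl
  tfae_have 2 ↔ 3 := Iff.rfl
  tfae_finish

end RComplex.HasCyclicBottom

/-! ### DG primes -/

section DGAlgebra

variable {A₀ : Type u} [CommRing A₀] {A : Type u} [Ring A] [Algebra A₀ A]
  {𝒜 : ℤ → Submodule A₀ A} [GradedAlgebra 𝒜] {d : A →ₗ[A₀] A}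

namespace IsDGAlgebra

variable (h : IsDGAlgebra 𝒜 d)

include h in
lemma proj_zero_mul (a b : A) :
    GradedRing.proj 𝒜 0 (a * b) = GradedRing.proj 𝒜 0 a * GradedRing.proj 𝒜 0 b := by
  have hom (i j : ℤ) {a b : A} (ha : a ∈ 𝒜 i) (hb : b ∈ 𝒜 j) :
      GradedRing.proj 𝒜 0 (a * b) = GradedRing.proj 𝒜 0 a * GradedRing.proj 𝒜 0 b := by
    simp only [GradedRing.proj_apply]
    by_cases hi : i < 0
    · rw [h.eq_bot_of_neg i hi, Submodule.mem_bot] at ha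
      simp [ha]
    by_cases hj : j < 0
    · rw [h.eq_bot_of_neg j hj, Submodule.mem_bot] at hb
      simp [hb]
    by_cases hi0 : i = 0
    · subst hi0
      by_cases hj0 : j = 0
      · subst hj0
        rw [DirectSum.decompose_of_mem_same 𝒜 ha, DirectSum.decompose_of_mem_same 𝒜 hb,
          DirectSum.decompose_of_mem_same 𝒜 (by simpa using SetLike.mul_mem_graded ha hb)]
      · rw [DirectSum.decompose_of_mem_ne 𝒜 hb hj0,
          DirectSum.decompose_of_mem_ne 𝒜 (SetLike.mul_mem_graded ha hb) (by lia), mul_zero]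
    · rw [DirectSum.decompose_of_mem_ne 𝒜 ha hi0,
        DirectSum.decompose_of_mem_ne 𝒜 (SetLike.mul_mem_graded ha hb) (by lia), zero_mul]
  induction a using DirectSum.Decomposition.inductionOn 𝒜 with
  | zero => simp
  | add a a' ha ha' => rw [add_mul, map_add, ha, ha', map_add, add_mul]
  | homogeneous a =>
    induction b using DirectSum.Decomposition.inductionOn 𝒜 with
    | zero => simp
    | add b b' hb hb' => rw [mul_add, map_add, hb, hb', map_add, mul_add]
    | homogeneous b => exact hom _ _ a.2 b.2

/-- The augmentation `A → A₀`, which is the projection to the component of degree `0`. It is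
multiplicative as `A` is positively graded. -/
noncomputable def augmentation : A →+* A₀ :=
  have hex (a : A) : ∃ r, algebraMap A₀ A r = GradedRing.proj 𝒜 0 a :=
    h.exists_algebraMap_eq _ (SetLike.coe_mem _)
  { toFun := fun a => (hex a).choose
    map_one' := h.algebraMap_injective <| by
      rw [(hex 1).choose_spec, (algebraMap A₀ A).map_one, GradedRing.proj_apply,
        DirectSum.decompose_of_mem_same 𝒜 SetLike.GradedOne.one_mem]
    map_zero' := h.algebraMap_injective <| by rw [(hex 0).choose_spec, map_zero, map_zero]
    map_mul' := fun a b => h.algebraMap_injective <| by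
      rw [(hex (a * b)).choose_spec, (algebraMap A₀ A).map_mul, (hex a).choose_spec,
        (hex b).choose_spec, h.proj_zero_mul]
    map_add' := fun a b => h.algebraMap_injective <| by
      rw [(hex (a + b)).choose_spec, (algebraMap A₀ A).map_add, (hex a).choose_spec,
        (hex b).choose_spec, map_add] }

lemma algebraMap_augmentation (a : A) :
    algebraMap A₀ A (h.augmentation a) = (DirectSum.decompose 𝒜 a 0 : A) :=
  (h.exists_algebraMap_eq _ (SetLike.coe_mem (DirectSum.decompose 𝒜 a 0))).choose_spec

lemma augmentation_of_mem_ne {i : ℤ} {a : A} (ha : a ∈ 𝒜 i) (hi : i ≠ 0) :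
    h.augmentation a = 0 :=
  h.algebraMap_injective <| by
    rw [h.algebraMap_augmentation, DirectSum.decompose_of_mem_ne 𝒜 ha hi, map_zero]

lemma algebraMap_augmentation_of_mem {a : A} (ha : a ∈ 𝒜 0) :
    algebraMap A₀ A (h.augmentation a) = a := by
  rw [h.algebraMap_augmentation, DirectSum.decompose_of_mem_same 𝒜 ha]

lemma algebraMap_mem_zero (r : A₀) : algebraMap A₀ A r ∈ 𝒜 0 := by
  rw [Algebra.algebraMap_eq_smul_one]
  exact (𝒜 0).smul_mem r SetLike.GradedOne.one_mem

lemma augmentation_algebraMap (r : A₀) : h.augmentation (algebraMap A₀ A r) = r :=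
  h.algebraMap_injective (h.algebraMap_augmentation_of_mem (algebraMap_mem_zero r))

lemma augmentation_d_mem (a : A) : h.augmentation (d a) ∈ boundaryIdeal 𝒜 d := by
  induction a using DirectSum.Decomposition.inductionOn 𝒜 with
  | zero => simp
  | add a b ha hb => rw [map_add, map_add]; exact add_mem ha hb
  | @homogeneous i a =>
    have hd := h.d_mem a.2
    by_cases hi : i = 1
    · subst hi
      refine ⟨a, a.2, ?_⟩
      exact (h.algebraMap_augmentation_of_mem hd).symm
    · rw [h.augmentation_of_mem_ne hd (by lia)]
      exact zero_mem _

/-- For a prime `p` of `A₀` that contains the boundaries, `p ⊕ A_{>0}` is a DG prime. -/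
lemma isDGPrime_comap_augmentation {p : Ideal A₀} (hp : p.IsPrime)
    (hle : boundaryIdeal 𝒜 d ≤ p) : IsDGPrime 𝒜 d (p.comap h.augmentation) where
  isHomogeneous i a ha := by
    rw [Ideal.mem_comap] at ha ⊢
    by_cases hi : i = 0
    · subst hi
      rwa [← h.algebraMap_augmentation, h.augmentation_algebraMap]
    · rw [h.augmentation_of_mem_ne (SetLike.coe_mem _) hi]
      exact zero_mem _
  d_mem a _ := hle (h.augmentation_d_mem a)
  isPrime := hp.comap _

lemma algebraMap_augmentation_mem_iff {I : Ideal A} (hpos : ∀ i ≠ 0, ∀ a ∈ 𝒜 i, a ∈ I) (a : A) :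
    algebraMap A₀ A (h.augmentation a) ∈ I ↔ a ∈ I := by
  have hsub : a - algebraMap A₀ A (h.augmentation a) ∈ I := by
    induction a using DirectSum.Decomposition.inductionOn 𝒜 with
    | zero => simp
    | add a b ha hb =>
      rw [map_add, map_add, add_sub_add_comm]
      exact add_mem ha hb
    | @homogeneous i a =>
      by_cases hi : i = 0
      · subst hi
        rw [h.algebraMap_augmentation_of_mem a.2, sub_self]
        exact zero_mem _
      · rw [h.augmentation_of_mem_ne a.2 hi, map_zero, sub_zero]
        exact hpos i hi a a.2
  exact ⟨fun ha => by simpa using add_mem hsub ha, fun ha => by simpa using sub_mem ha hsub⟩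

/-- If each DG prime contains `A_{>0}`, then the DG primes of `A` correspond to the primes of `A₀`
that contain the boundaries, that is, to the primes of `H₀(A)`. -/
noncomputable def dgPrimeOrderIso
    (hpos : ∀ I : Ideal A, IsDGPrime 𝒜 d I → ∀ i ≠ 0, ∀ a ∈ 𝒜 i, a ∈ I) :
    {I : Ideal A // IsDGPrime 𝒜 d I} ≃o
      PrimeSpectrum.zeroLocus (boundaryIdeal 𝒜 d : Set A₀) where
  toFun I := ⟨⟨I.1.comap (algebraMap A₀ A), I.2.isPrime.comap _⟩, by
    rintro r ⟨a, ha, hr⟩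
    change algebraMap A₀ A r ∈ I.1
    rw [← Algebra.linearMap_apply, ← hr]
    exact I.2.d_mem a (hpos I.1 I.2 1 one_ne_zero a ha)⟩
  invFun p := ⟨p.1.asIdeal.comap h.augmentation, h.isDGPrime_comap_augmentation p.1.2 p.2⟩
  left_inv I := Subtype.ext (Ideal.ext (h.algebraMap_augmentation_mem_iff (hpos I.1 I.2)))
  right_inv p := by
    refine Subtype.ext (PrimeSpectrum.ext (Ideal.ext fun r => ?_))
    change h.augmentation (algebraMap A₀ A r) ∈ p.1.asIdeal ↔ r ∈ p.1.asIdeal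
    rw [h.augmentation_algebraMap]
  map_rel_iff' {I I'} := by
    refine ⟨fun hle a ha => ?_, fun hle => Ideal.comap_mono hle⟩
    have hmem : h.augmentation a ∈ I.1.comap (algebraMap A₀ A) :=
      (h.algebraMap_augmentation_mem_iff (hpos I.1 I.2) a).2 ha
    exact (h.algebraMap_augmentation_mem_iff (hpos I'.1 I'.2) a).1 (hle hmem)

include h in
/-- Homogeneous elements of odd degree square to zero, and so lie in every DG prime. -/
lemma mem_of_generatedInOddDegrees (hgen : GeneratedInOddDegrees 𝒜) {I : Ideal A}
    (hI : IsDGPrime 𝒜 d I) {i : ℤ} (hi : i ≠ 0) {a : A} (ha : a ∈ 𝒜 i) : a ∈ I := by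
  have hsub (a : A) : ∃ r : A₀, a - algebraMap A₀ A r ∈ I := by
    have hmem : a ∈ Algebra.adjoin A₀ {a : A | ∃ i : ℤ, Odd i ∧ a ∈ 𝒜 i} :=
      hgen ▸ Algebra.mem_top
    induction hmem using Algebra.adjoin_induction with
    | mem a ha =>
      obtain ⟨i, hi, ha⟩ := ha
      have : a * a ∈ I := by rw [h.mul_self_of_odd hi ha]; exact zero_mem _
      exact ⟨0, by simpa using hI.isPrime.mem_or_mem this⟩
    | algebraMap r => exact ⟨r, by simp⟩
    | add a b _ _ ha hb =>
      obtain ⟨r, hr⟩ := ha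
      obtain ⟨s, hs⟩ := hb
      exact ⟨r + s, by rw [map_add, add_sub_add_comm]; exact add_mem hr hs⟩
    | mul a b _ _ ha hb =>
      obtain ⟨r, hr⟩ := ha
      obtain ⟨s, hs⟩ := hb
      refine ⟨r * s, ?_⟩
      have : a * b - algebraMap A₀ A (r * s) = a * (b - algebraMap A₀ A s) +
          algebraMap A₀ A s * (a - algebraMap A₀ A r) := by
        rw [mul_sub, mul_sub, Algebra.commutes s a, map_mul, ← Algebra.commutes s]
        abel
      rw [this]
      exact add_mem (I.mul_mem_left _ hs) (I.mul_mem_left _ hr)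
  obtain ⟨r, hr⟩ := hsub a
  have := hI.isHomogeneous i hr
  rwa [DirectSum.decompose_sub, DirectSum.sub_apply, AddSubgroupClass.coe_sub,
    DirectSum.decompose_of_mem_same 𝒜 ha,
    DirectSum.decompose_of_mem_ne 𝒜 (algebraMap_mem_zero r) hi.symm, sub_zero] at this

include h in
/-- Homogeneous elements of positive degree in a bounded algebra are nilpotent, and so lie in every
DG prime. -/
lemma mem_of_isBoundedDG (hbdd : IsBoundedDG 𝒜) {I : Ideal A}
    (hI : IsDGPrime 𝒜 d I) {i : ℤ} (hi : i ≠ 0) {a : A} (ha : a ∈ 𝒜 i) : a ∈ I := by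
  rcases lt_or_gt_of_ne hi with hneg | hpos
  · rw [h.eq_bot_of_neg i hneg, Submodule.mem_bot] at ha
    exact ha ▸ zero_mem _
  · obtain ⟨N, hN⟩ := hbdd
    have hpow (n : ℕ) (hn : a ^ n ∈ I) : a ∈ I := by
      induction n with
      | zero => exact absurd (I.eq_top_iff_one.2 (by simpa using hn)) hI.isPrime.ne_top
      | succ n ih =>
        rw [pow_succ] at hn
        exact (hI.isPrime.mem_or_mem hn).elim ih id
    refine hpow (N.toNat + 1) ?_
    have hmem := SetLike.pow_mem_graded (N.toNat + 1) ha
    rw [hN _ (by rw [nsmul_eq_mul]; push_cast; nlinarith [Int.self_le_toNat N]),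
      Submodule.mem_bot] at hmem
    rw [hmem]
    exact zero_mem _

include h in
lemma dgDim_eq (hA : GeneratedInOddDegrees 𝒜 ∨ IsBoundedDG 𝒜) :
    dgDim 𝒜 d = ringKrullDim (HZero 𝒜 d) := by
  rw [dgDim, ringKrullDim_quotient]
  exact Order.krullDim_eq_of_orderIso <| h.dgPrimeOrderIso fun I hI i hi a ha =>
    hA.elim (fun hgen => h.mem_of_generatedInOddDegrees hgen hI hi ha)
      (fun hbdd => h.mem_of_isBoundedDG hbdd hI hi ha)

end IsDGAlgebra

end DGAlgebra

theorem theorem1p2 {A₀ : Type u} [CommRing A₀] [IsLocalRing A₀] [IsNoetherianRing A₀]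
    {A : Type u} [Ring A] [Algebra A₀ A] (𝒜 : ℤ → Submodule A₀ A) [GradedAlgebra 𝒜]
    (d : A →ₗ[A₀] A) (hA : IsDGAlgebra 𝒜 d) (hfin : hA.toComplex.HomologicallyFinite)
    (hloc : hA.IsLocal) :
    (∀ xs : List A₀, (∀ x ∈ xs, x ∈ IsLocalRing.maximalIdeal A₀) →
      List.TFAE [RComplex.IsChristensenSOP xs hA.toComplex,
        IsModuleSOP xs (HZero 𝒜 d),
        RComplex.IsLengthSOP xs hA.toComplex]) ∧
    (hA.toComplex.ldim = hA.toComplex.dim ∧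
      hA.toComplex.dim = dimToEReal (ringKrullDim (HZero 𝒜 d))) ∧
    ((GeneratedInOddDegrees 𝒜 ∨ IsBoundedDG 𝒜) →
      dimToEReal (dgDim 𝒜 d) = hA.toComplex.ldim ∧
        hA.toComplex.ldim = hA.toComplex.dim ∧
        hA.toComplex.dim = dimToEReal (ringKrullDim (HZero 𝒜 d))) := by
  have hY := hA.hasCyclicBottom_toComplex hloc.isNoetherian.finite_homology
  have hJ : boundaryIdeal 𝒜 d ≠ ⊤ := by
    have := hloc.isLocalRing
    exact Ideal.Quotient.nontrivial_iff.1 inferInstance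
  have hdim := hY.dim_eq hJ
  have hldim := hY.ldim_eq hJ
  refine ⟨fun xs hxs => hY.tfae_systemOfParameters hJ hxs, ⟨hldim.trans hdim.symm, hdim⟩,
    fun hgen => ⟨?_, hldim.trans hdim.symm, hdim⟩⟩
  rw [hA.dgDim_eq hgen, hldim]
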